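/- Let $\mathbb F_q$ be a finite field and let $H_1(D)\in\mathbb F_q[D]^{(n-k_1)\times n}$ and $H_2(D)\in\mathbb F_q[D]^{k_2\times n}$ be parity check matrices of two classical convolutional codes $C_1=(n,k_1)$ and $C_2=(n,n-k_2)$ with $C_2^\perp\subseteq C_1$. Here duality and parity checks refer to the inner product of finitely supported sequences and all their shifts, that is, to $\langle v,w\rangle=\sum_j v_j(D)\,w_j(1/D)$ on $\mathbb F_q[D,D^{-1}]^n$. Assume that both $H_i(D)$ have full row rank and that the encoders $u(D)\mapsto u(D)H_i(D)$ are non-catastrophic (if $u(D)\in\mathbb F_q[[D]]^{r}$ and $u(D)H_i(D)$ is polynomial, then $u(D)$ is polynomial) and delay-free ($H_i(0)$ has full row rank). Let $\mathcal C$ be the quantum convolutional code with stabilizer matrix $$S(D)=(X(D)\,|\,Z(D))=\left(\begin{array}{c|c}H_2(D)&0\\0&H_1(D)\end{array}\right),$$ with frame size $n$ and constraint length $\nu=\sum_i\nu_i$, where $\nu_i$ is the largest degree of an entry of the $i$-th row of $S(D)$. A circuit is a finite sequence of the following generalized Clifford gates, each applied in every frame of the stream, and acting on the columns of $(X(D)|Z(D))$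 as indicated: on qudit $i$ of each frame, the Fourier transform $\left(\begin{smallmatrix}0&-1\\1&0\end{smallmatrix}\right)$, the multiplication gates $\left(\begin{smallmatrix}\gamma^{-1}&0\\0&\gamma\end{smallmatrix}\right)$ with $\gamma\neq0$, and the diagonal gates $\left(\begin{smallmatrix}1&\gamma\\0&1\end{smallmatrix}\right)$; the gate ADD from qudit $i$ of frame $t$ to qudit $j\ne i$ of frame $t+\ell$ (for all $t$), which adds $D^\ell X_i$ to $X_j$ and subtracts $D^{-\ell}Z_j$ from $Z_i$; and the controlled phase gate between qudit $i$ of frame $t$ and qudit $i$ of frame $t+\ell$ (for all $t$; $\ell\ne0$), which adds $(D^\ell+D^{-\ell})X_i$ to $Z_i$. A circuit is an encoding circuit for $\mathcal C$ if it changes the trivial stabilizer matrix $S_0=(0\,|\,I\;0)$, with as many rows as $S(D)$, into a matrix that generates the same stabilizer as $S(D)$, i.e. has the same row span over $\mathbb F_q[D,D^{-1}]$. Its depth on a stream of $N$ frames is the least number of time steps in which all the gates acting on qudits of these $N$ frames can be executed when gates that share a qudit are executed in different time steps and in the order of the circuit (the mutually commuting copies of one controlled phase gate being ordered as follows: first the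 copies whose $t$ has $\lfloor t/|\ell|\rfloor$ even, then the others). Then $\mathcal C$ has an encoding circuit whose depth is bounded independently of the length $N$ of the stream. More precisely, there is a polynomial $p$ in two variables, not depending on the code, on $q$, or on $N$, such that every such code has an encoding circuit whose depth on a stream of $N$ frames is at most $p(n,\nu)$ for all $N$. -/

import Mathlib

open Polynomial LaurentPolynomial

namespace QCC

noncomputable section

/-! ### Classical convolutional codes -/

/-- The delay operator `D` is the variable; the entry `v j` is the (finitely supported) sequence
carried by the `j`-th position of the frames.  The coefficient of `D ^ s` in this Laurent
polynomial is the ordinary inner product of the sequence `v` with the sequence `w` delayed by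
`s` frames. -/
def seqInner {F : Type*} [Field F] {n : ℕ} (v w : Fin n → F[T;T⁻¹]) : F[T;T⁻¹] :=
  ∑ j, v j * LaurentPolynomial.invert (w j)

/-- The convolutional code with parity check matrix `H(D)`: all sequences that are orthogonal to
every row of `H(D)` and to all the shifts of these rows. -/
def parityCode {F : Type*} [Field F] {r n : ℕ} (H : Matrix (Fin r) (Fin n) F[X]) :
    Submodule F[T;T⁻¹] (Fin n → F[T;T⁻¹]) where
  carrier := {c | ∀ i, seqInner (fun j => toLaurent (H i j)) c = 0}
  zero_mem' := by intro i; simp [seqInner]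
  add_mem' := by
    intro a b ha hb i
    have ha' := ha i
    have hb' := hb i
    simp only [seqInner] at ha' hb' ⊢
    simp [mul_add, Finset.sum_add_distrib, ha', hb']
  smul_mem' := by
    intro a c hc i
    have hc' := hc i
    simp only [seqInner] at hc' ⊢
    simp only [Pi.smul_apply, smul_eq_mul, map_mul, mul_left_comm, ← Finset.mul_sum, hc', mul_zero]

/-- The dual code: all sequences orthogonal to every shift of every code sequence. -/
def dualCode {F : Type*} [Field F] {n : ℕ} (C : Submodule F[T;T⁻¹] (Fin n → F[T;T⁻¹])) :
    Submodule F[T;T⁻¹] (Fin n → F[T;T⁻¹]) where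
  carrier := {v | ∀ c ∈ C, seqInner c v = 0}
  zero_mem' := by intro c _; simp [seqInner]
  add_mem' := by
    intro a b ha hb c hc
    have ha' := ha c hc
    have hb' := hb c hc
    simp only [seqInner] at ha' hb' ⊢
    simp [mul_add, Finset.sum_add_distrib, ha', hb']
  smul_mem' := by
    intro a v hv c hc
    have hv' := hv c hc
    simp only [seqInner] at hv' ⊢
    simp only [Pi.smul_apply, smul_eq_mul, map_mul]
    simp_rw [mul_left_comm _ (LaurentPolynomial.invert a)]
    rw [← Finset.mul_sum, hv', mul_zero]

/-- The encoder `u(D) ↦ u(D) G(D)` is non-catastrophic: an information stream whose code stream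
has finite weight (all components are polynomials) has finite weight itself. -/
def NonCatastrophic {F : Type*} [Field F] {r n : ℕ} (G : Matrix (Fin r) (Fin n) F[X]) : Prop :=
  ∀ u : Fin r → PowerSeries F,
    (∀ j, ∃ w : F[X], ∑ i, u i * (G i j : PowerSeries F) = (w : PowerSeries F)) →
      ∀ i, ∃ p : F[X], u i = (p : PowerSeries F)

/-- The encoder `u(D) ↦ u(D) G(D)` is delay-free: `G(0)` has full row rank. -/
def DelayFree {F : Type*} [Field F] {r n : ℕ} (G : Matrix (Fin r) (Fin n) F[X]) : Prop :=
  LinearIndependent F (fun i => fun j => (G i j).eval 0)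

/-- Full row rank of a polynomial matrix. -/
def FullRank {F : Type*} [Field F] {r n : ℕ} (G : Matrix (Fin r) (Fin n) F[X]) : Prop :=
  LinearIndependent F[X] (fun i => G i)

/-! ### Stabilizer matrices `(X(D) | Z(D))`

Columns are indexed by `Fin n ⊕ Fin n`: the left summand is the `X`-part, the right one the
`Z`-part. -/

/-- The stabilizer matrix `(H₂ | 0 ; 0 | H₁)` of the CSS-like construction. -/
def cssStabilizer {F : Type*} [Field F] {n r₁ k₂ : ℕ}
    (H₁ : Matrix (Fin r₁) (Fin n) F[X]) (H₂ : Matrix (Fin k₂) (Fin n) F[X]) :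
    Matrix (Fin k₂ ⊕ Fin r₁) (Fin n ⊕ Fin n) F[X] :=
  Matrix.fromBlocks H₂ 0 0 H₁

/-- The overall constraint length `ν = ∑ i, ν i`, where `ν i` is the largest degree of an entry of
the `i`-th row (over both the `X`-part and the `Z`-part). -/
def constraintLength {F : Type*} [Field F] {n : ℕ} {ρ : Type*} [Fintype ρ]
    (S : Matrix ρ (Fin n ⊕ Fin n) F[X]) : ℕ :=
  ∑ i, Finset.univ.sup fun j => (S i j).natDegree

/-- The `Z`-only stabilizer matrix `S₀ = (0 | I 0)` with `r` rows: the first `r` qudits of every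
frame are ancillae in the state `|0⟩`. -/
def trivialStabilizer (F : Type*) [Field F] (n r : ℕ) :
    Matrix (Fin r) (Fin n ⊕ Fin n) F[T;T⁻¹] :=
  Matrix.of fun i => Sum.elim (fun _ => 0) (fun j => if (i : ℕ) = (j : ℕ) then 1 else 0)

/-- The stabilizer generated by the rows of a matrix and all their shifts, with the Pauli operators
written as vectors `(X(D) | Z(D))`. -/
def stabilizerSpan {F : Type*} [Field F] {n : ℕ} {ρ : Type*}
    (S : Matrix ρ (Fin n ⊕ Fin n) F[T;T⁻¹]) :
    Submodule F[T;T⁻¹] (Fin n ⊕ Fin n → F[T;T⁻¹]) :=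
  Submodule.span F[T;T⁻¹] (Set.range fun i => S i)

/-! ### Generalized Clifford gates and their action on stabilizer matrices -/

/-- The generalized Clifford gates on streams with frame size `n`.  Each of them stands for the
same gate applied in every frame: `add i j ℓ` is the gate `ADD` from qudit `i` of frame `t` to
qudit `j` of frame `t + ℓ`, and `cphase i ℓ` is the controlled phase gate on qudit `i` of frame `t`
and qudit `i` of frame `t + ℓ`, for all `t`. -/
inductive Gate (F : Type*) [Field F] (n : ℕ)
  | dft (i : Fin n) : Gate F n
  | mult (i : Fin n) (γ : Fˣ) : Gate F n
  | phase (i : Fin n) (γ : F) : Gate F n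
  | add (i j : Fin n) (ℓ : ℤ) (h : i ≠ j) : Gate F n
  | cphase (i : Fin n) (ℓ : ℤ) (h : ℓ ≠ 0) : Gate F n

/-- The matrix that acts as `!![a, b; c, d]` on the columns `X i` and `Z i`, and as the identity on
all other columns. -/
def singleQudit {F : Type*} [Field F] {n : ℕ} (i : Fin n) (a b c d : F[T;T⁻¹]) :
    Matrix (Fin n ⊕ Fin n) (Fin n ⊕ Fin n) F[T;T⁻¹] :=
  Matrix.fromBlocks
    (Matrix.diagonal (Function.update 1 i a)) (Matrix.single i i b)
    (Matrix.single i i c) (Matrix.diagonal (Function.update 1 i d))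

/-- The action (from the right) of a gate on the columns of `(X(D) | Z(D))`. -/
def Gate.matrix {F : Type*} [Field F] {n : ℕ} :
    Gate F n → Matrix (Fin n ⊕ Fin n) (Fin n ⊕ Fin n) F[T;T⁻¹]
  | .dft i => singleQudit i 0 (-1) 1 0
  | .mult i γ =>
      singleQudit i (LaurentPolynomial.C ((γ⁻¹ : Fˣ) : F)) 0 0 (LaurentPolynomial.C (γ : F))
  | .phase i γ => singleQudit i 1 (LaurentPolynomial.C γ) 0 1
  | .add i j ℓ _ =>
      Matrix.fromBlocks (1 + Matrix.single i j (LaurentPolynomial.T ℓ)) 0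
        0 (1 - Matrix.single j i (LaurentPolynomial.T (-ℓ)))
  | .cphase i ℓ _ => singleQudit i 1 (LaurentPolynomial.T ℓ + LaurentPolynomial.T (-ℓ)) 0 1

/-- A circuit is a sequence of gates, in the order in which they are applied. -/
abbrev Circuit (F : Type*) [Field F] (n : ℕ) := List (Gate F n)

/-- The action of a circuit on the columns of `(X(D) | Z(D))`. -/
def Circuit.matrix {F : Type*} [Field F] {n : ℕ} (c : Circuit F n) :
    Matrix (Fin n ⊕ Fin n) (Fin n ⊕ Fin n) F[T;T⁻¹] :=
  (c.map Gate.matrix).prod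

/-- `c` is an encoding circuit for the quantum convolutional code with stabilizer matrix `S(D)`:
it changes the stabilizer generated by `S₀ = (0 | I 0)`, which has as many rows as `S(D)`, into the
stabilizer generated by `S(D)`. -/
def Circuit.IsEncoder {F : Type*} [Field F] {n : ℕ} {ρ : Type*} [Fintype ρ] (c : Circuit F n)
    (S : Matrix ρ (Fin n ⊕ Fin n) F[X]) : Prop :=
  stabilizerSpan (trivialStabilizer F n (Fintype.card ρ) * Circuit.matrix c) =
    stabilizerSpan (S.map toLaurent)

/-! ### The circuit on a stream of `N` frames, and its depth -/

/-- The qudit at position `q.2` of frame `q.1`. -/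
abbrev Qudit (n : ℕ) := ℤ × Fin n

/-- Gates on individual qudits of the stream. -/
inductive QuditGate (F : Type*) [Field F] (n : ℕ)
  | dft (q : Qudit n) : QuditGate F n
  | mult (q : Qudit n) (γ : Fˣ) : QuditGate F n
  | phase (q : Qudit n) (γ : F) : QuditGate F n
  | add (q q' : Qudit n) : QuditGate F n
  | cphase (q q' : Qudit n) : QuditGate F n

/-- The qudits on which a gate acts. -/
def QuditGate.support {F : Type*} [Field F] {n : ℕ} : QuditGate F n → Finset (Qudit n)
  | .dft q => {q}
  | .mult q _ => {q}
  | .phase q _ => {q}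
  | .add q q' => {q, q'}
  | .cphase q q' => {q, q'}

/-- The frames `t` of the stream of the `N` frames `0, …, N - 1` for which frame `t + ℓ` belongs to
the stream as well. -/
def framePositions (N : ℕ) (ℓ : ℤ) : List ℤ :=
  ((List.range N).map fun t => (t : ℤ)).filter fun t => decide (0 ≤ t + ℓ ∧ t + ℓ < N)

/-- The gates on individual qudits that make up a gate on a stream of `N` frames.  The copies of
`cphase i ℓ` commute; they are listed such that first come those that start in an even block of `|ℓ|`
consecutive frames, then the others. -/
def Gate.unroll {F : Type*} [Field F] {n : ℕ} (N : ℕ) : Gate F n → List (QuditGate F n)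
  | .dft i => (framePositions N 0).map fun t => .dft (t, i)
  | .mult i γ => (framePositions N 0).map fun t => .mult (t, i) γ
  | .phase i γ => (framePositions N 0).map fun t => .phase (t, i) γ
  | .add i j ℓ _ => (framePositions N ℓ).map fun t => .add (t, i) (t + ℓ, j)
  | .cphase i ℓ _ =>
      (((framePositions N ℓ).filter fun t => decide (Even (t / |ℓ|))) ++
        ((framePositions N ℓ).filter fun t => decide (¬ Even (t / |ℓ|)))).map
          fun t => .cphase (t, i) (t + ℓ, i)

/-- The gates on individual qudits that make up a circuit on a stream of `N` frames, in order. -/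
def Circuit.unroll {F : Type*} [Field F] {n : ℕ} (N : ℕ) (c : Circuit F n) :
    List (QuditGate F n) :=
  c.flatMap (Gate.unroll N)

/-- The gates can be executed in `d` time steps: gates that share a qudit are executed in different
time steps, in the given order. -/
def RunsInTime {F : Type*} [Field F] {n : ℕ} (g : List (QuditGate F n)) (d : ℕ) : Prop :=
  ∃ τ : Fin g.length → Fin d, ∀ a b : Fin g.length, a < b →
    ¬ Disjoint (g.get a).support (g.get b).support → τ a < τ b

/-- The depth: the least number of time steps.  (Always attained: `g.length` steps suffice.) -/
def quditDepth {F : Type*} [Field F] {n : ℕ} (g : List (QuditGate F n)) : ℕ :=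
  sInf {d | RunsInTime g d}

/-- The depth of a circuit on a stream of `N` frames. -/
def Circuit.depth {F : Type*} [Field F] {n : ℕ} (c : Circuit F n) (N : ℕ) : ℕ :=
  quditDepth (Circuit.unroll N c)

end

end QCC

open Polynomial LaurentPolynomial

namespace QCC

noncomputable section

/-! ### Elementary column operations -/

/-! The stabilizer consists of all `(x | z)` with `x` in the row module of `H₂` and `z` in that of
`H₁`. An ADD gate between two multiplication gates is an elementary column operation on the
`X`-part, with a dual operation on the `Z`-part; the pair preserves `seqInner`. The task is to bring
both row modules to coordinate form by polynomially many such operations. Fourier transforms and a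
permutation then lead to the trivial stabilizer, and the encoder is this process run backwards
(`exists_encoder`).

A non-catastrophic encoder has a row module with torsion-free quotient
(`NonCatastrophic.saturated`). Such a module is reduced by descent on the number of active columns
plus the sum of the row degree bounds (`reducible_rowModule`). If the columns of the top coefficient
matrix are independent, the module is everything on the active columns (`rowModule_eq_coord`).
Otherwise a dependency lowers the degrees in one column (`exists_ops_lower_degree`). That column is
then zero and can be discarded, or it has room for an extra factor `D`, which allows one row to be
made divisible by `D` and its degree bound to drop (`exists_ops_lower_row`). The column delays used
here cost no gates, since they can be commuted to the end, where they fix coordinate submodules.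

Once `H₂` is reduced to the coordinates in `J₂`, orthogonality forces the transformed `H₁` to vanish
on `J₂`. It can therefore be reduced on the complement without disturbing the first result
(`exists_ops_reduce_both`).

No controlled phase gate is needed. The copies of any other gate act on disjoint qudits, so the
depth is at most the number of gates, whatever the length of the stream. -/

/-- The elementary column operation that adds `coeff * D ^ shift` times column `src` to column
`tgt`. -/
structure ColumnOp (F : Type*) [Field F] (n : ℕ) where
  src : Fin n
  tgt : Fin n
  ne : src ≠ tgt
  coeff : F
  shift : ℤ

namespace ColumnOp

variable {F : Type*} [Field F] {n : ℕ}

/-- The action of a column operation on row vectors. -/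
def act (o : ColumnOp F n) : (Fin n → F[T;T⁻¹]) →ₗ[F[T;T⁻¹]] (Fin n → F[T;T⁻¹]) :=
  LinearMap.id + (LinearMap.single F[T;T⁻¹] (fun _ : Fin n => F[T;T⁻¹]) o.tgt) ∘ₗ
    ((LaurentPolynomial.C o.coeff * T o.shift) • LinearMap.proj o.src)

theorem act_apply (o : ColumnOp F n) (v : Fin n → F[T;T⁻¹]) (j : Fin n) :
    o.act v j =
      v j + if j = o.tgt then LaurentPolynomial.C o.coeff * T o.shift * v o.src else 0 := by
  simp [act, Pi.single_apply]

/-- The inverse column operation. -/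
def inv (o : ColumnOp F n) : ColumnOp F n := { o with coeff := -o.coeff }

/-- The column operation that acts on the `Z`-part when `o` acts on the `X`-part. -/
def dual (o : ColumnOp F n) : ColumnOp F n where
  src := o.tgt
  tgt := o.src
  ne := o.ne.symm
  coeff := -o.coeff
  shift := -o.shift

@[simp] theorem dual_dual (o : ColumnOp F n) : o.dual.dual = o := by
  cases o; simp [dual]

@[simp] theorem inv_inv (o : ColumnOp F n) : o.inv.inv = o := by
  cases o; simp [inv]

theorem dual_inv (o : ColumnOp F n) : o.inv.dual = o.dual.inv := rfl

theorem act_inv_act (o : ColumnOp F n) (v : Fin n → F[T;T⁻¹]) : o.inv.act (o.act v) = v := by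
  funext j
  have h := o.ne
  by_cases hj : j = o.tgt
  · subst hj
    simp [act_apply, inv, h]
  · simp [act_apply, inv, hj]

/-- Column operations preserve the inner product of sequences. -/
theorem seqInner_act (o : ColumnOp F n) (v w : Fin n → F[T;T⁻¹]) :
    seqInner (o.act v) (o.dual.act w) = seqInner v w := by
  have h := o.ne
  unfold seqInner
  -- The `tgt` term gains exactly what the `src` term loses: `invert` turns the dual shift back into
  -- the original one. There is no second-order term because `src ≠ tgt`.
  have : ∀ j, o.act v j * invert (o.dual.act w j) = v j * invert (w j)
      + ((if j = o.tgt then LaurentPolynomial.C o.coeff * T o.shift * v o.src * invert (w o.tgt)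
          else 0)
        - (if j = o.src then LaurentPolynomial.C o.coeff * T o.shift * v o.src * invert (w o.tgt)
          else 0)) := by
    intro j
    rw [act_apply, act_apply]
    by_cases h1 : j = o.tgt
    · subst h1
      simp [dual, h.symm]
      ring
    · by_cases h2 : j = o.src
      · subst h2
        simp [dual, h]
        ring
      · simp [dual, h1, h2]
  simp [this, Finset.sum_add_distrib]

/-- The successive action of a list of column operations. -/
def actList : List (ColumnOp F n) → ((Fin n → F[T;T⁻¹]) →ₗ[F[T;T⁻¹]] (Fin n → F[T;T⁻¹]))
  | [] => LinearMap.id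
  | o :: os => actList os ∘ₗ o.act

@[simp] theorem actList_nil : actList ([] : List (ColumnOp F n)) = LinearMap.id := rfl

@[simp] theorem actList_cons (o : ColumnOp F n) (os : List (ColumnOp F n)) :
    actList (o :: os) = actList os ∘ₗ o.act := rfl

theorem actList_append (l₁ l₂ : List (ColumnOp F n)) :
    actList (l₁ ++ l₂) = actList l₂ ∘ₗ actList l₁ := by
  induction l₁ with
  | nil => rfl
  | cons o os ih => simp [ih, LinearMap.comp_assoc]

/-- The list of column operations that undoes a list of column operations. -/
def invList (l : List (ColumnOp F n)) : List (ColumnOp F n) := (l.map inv).reverse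

theorem invList_invList (l : List (ColumnOp F n)) : invList (invList l) = l := by
  simp [invList, Function.comp_def]

theorem actList_invList_apply (l : List (ColumnOp F n)) (v : Fin n → F[T;T⁻¹]) :
    actList (invList l) (actList l v) = v := by
  induction l generalizing v with
  | nil => rfl
  | cons o os ih =>
    have : invList (o :: os) = invList os ++ [o.inv] := by simp [invList]
    simp [this, actList_append, ih, act_inv_act]

theorem actList_bijective (l : List (ColumnOp F n)) : Function.Bijective (actList l) :=
  Function.bijective_iff_has_inverse.2 ⟨actList (invList l), actList_invList_apply l, fun v => by
    simpa [invList_invList] using actList_invList_apply (invList l) v⟩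

theorem map_actList_invList (l : List (ColumnOp F n))
    {M N : Submodule F[T;T⁻¹] (Fin n → F[T;T⁻¹])} (h : M.map (actList l) = N) :
    N.map (actList (invList l)) = M := by
  subst h
  rw [← Submodule.map_comp]
  convert Submodule.map_id M
  exact LinearMap.ext (actList_invList_apply l)

theorem seqInner_actList (l : List (ColumnOp F n)) (v w : Fin n → F[T;T⁻¹]) :
    seqInner (actList l v) (actList (l.map dual) w) = seqInner v w := by
  induction l generalizing v w with
  | nil => rfl
  | cons o os ih => simp [ih, seqInner_act]

/-- Conjugation of a column operation by a delay of column `j₀`. -/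
def shiftAt (j₀ : Fin n) (e : ℤ) (o : ColumnOp F n) : ColumnOp F n :=
  { o with shift := o.shift + ((if o.tgt = j₀ then e else 0) - if o.src = j₀ then e else 0) }

end ColumnOp

/-! ### Column delays, and combined operations with a common column -/

variable {F : Type*} [Field F] {n : ℕ}

/-- The delay of column `j₀` by `e` frames. -/
def colShift (j₀ : Fin n) (e : ℤ) : (Fin n → F[T;T⁻¹]) →ₗ[F[T;T⁻¹]] (Fin n → F[T;T⁻¹]) :=
  LinearMap.pi fun j => (if j = j₀ then T e else 1 : F[T;T⁻¹]) • LinearMap.proj j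

theorem colShift_apply (j₀ : Fin n) (e : ℤ) (v : Fin n → F[T;T⁻¹]) (j : Fin n) :
    colShift j₀ e v j = (if j = j₀ then T e else 1) * v j := by
  simp only [colShift, LinearMap.pi_apply, LinearMap.smul_apply, LinearMap.proj_apply, smul_eq_mul]

theorem colShift_neg_apply (j₀ : Fin n) (e : ℤ) (v : Fin n → F[T;T⁻¹]) :
    colShift j₀ (-e) (colShift j₀ e v) = v := by
  funext j
  rw [colShift_apply, colShift_apply]
  split_ifs
  · rw [← mul_assoc, ← T_add]; simp
  · simp

theorem colShift_bijective (j₀ : Fin n) (e : ℤ) :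
    Function.Bijective (colShift (F := F) j₀ e) :=
  Function.bijective_iff_has_inverse.2 ⟨colShift j₀ (-e), colShift_neg_apply j₀ e, fun v => by
    simpa using colShift_neg_apply j₀ (-e) v⟩

/-- Delays normalize the elementary operations: passing one only changes the shift, by `e` if column
`j₀` is the target and by `-e` if it is the source. -/
theorem colShift_act (j₀ : Fin n) (e : ℤ) (o : ColumnOp F n) (v : Fin n → F[T;T⁻¹]) :
    colShift j₀ e (o.act v) = (o.shiftAt j₀ e).act (colShift j₀ e v) := by
  have h := o.ne
  funext j
  simp only [colShift_apply, ColumnOp.act_apply, ColumnOp.shiftAt]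
  by_cases hj : j = o.tgt
  · subst hj
    by_cases h1 : o.tgt = j₀
    · have h2 : o.src ≠ j₀ := fun h2 => h (h2.trans h1.symm)
      simp only [h1, h2, if_true, if_false, sub_zero, T_add]
      ring
    · by_cases h2 : o.src = j₀
      · simp only [h1, h2, if_true, if_false, zero_sub, T_add, one_mul]
        have : (T e : F[T;T⁻¹]) * T (-e) = 1 := by rw [← T_add]; simp
        linear_combination (-(LaurentPolynomial.C o.coeff * T o.shift * v j₀)) * this
      · simp [h1, h2]
  · simp [hj]

theorem colShift_comp_actList (j₀ : Fin n) (e : ℤ) (l : List (ColumnOp F n)) :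
    colShift j₀ e ∘ₗ ColumnOp.actList l =
      ColumnOp.actList (l.map (ColumnOp.shiftAt j₀ e)) ∘ₗ colShift j₀ e := by
  induction l with
  | nil => rfl
  | cons o os ih =>
    simp only [ColumnOp.actList_cons, List.map_cons, ← LinearMap.comp_assoc, ih]
    refine LinearMap.ext fun v => ?_
    simp [colShift_act]

/-- Adding multiples of the columns in `S` to column `j₀`. -/
theorem exists_ops_gather (j₀ : Fin n) (e : ℤ) (c : Fin n → F) (S : Finset (Fin n))
    (hS : j₀ ∉ S) :
    ∃ l : List (ColumnOp F n), l.length = S.card ∧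
      (∀ o ∈ l, o.src ∈ S ∧ o.tgt = j₀ ∧ o.shift = e) ∧
      ∀ v j, ColumnOp.actList l v j =
        v j + if j = j₀ then ∑ i ∈ S, LaurentPolynomial.C (c i) * T e * v i else 0 := by
  induction S using Finset.induction_on with
  | empty => exact ⟨[], by simp⟩
  | insert a S ha ih =>
    have haj : a ≠ j₀ := fun h => hS (by simp [h])
    obtain ⟨l, h1, h2, h3⟩ := ih fun h => hS (Finset.mem_insert_of_mem h)
    refine ⟨⟨a, j₀, haj, c a, e⟩ :: l, by simp [h1, ha], ?_, ?_⟩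
    · intro o ho
      rcases List.mem_cons.1 ho with rfl | ho
      · simp
      · exact ⟨Finset.mem_insert_of_mem (h2 o ho).1, (h2 o ho).2⟩
    · intro v j
      simp only [ColumnOp.actList_cons, LinearMap.comp_apply, h3, Finset.sum_insert ha]
      have : ∀ i ∈ S, (⟨a, j₀, haj, c a, e⟩ : ColumnOp F n).act v i = v i := by
        intro i hi
        have : i ≠ j₀ := fun h => hS (by simp [← h, hi])
        simp [ColumnOp.act_apply, this]
      rw [Finset.sum_congr rfl fun i hi => by rw [this i hi]]
      by_cases hj : j = j₀
      · simp [ColumnOp.act_apply, hj, add_assoc]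
      · simp [ColumnOp.act_apply, hj]

/-- Adding multiples of column `j₀` to the columns in `S`. -/
theorem exists_ops_spread (j₀ : Fin n) (e : ℤ) (c : Fin n → F) (S : Finset (Fin n))
    (hS : j₀ ∉ S) :
    ∃ l : List (ColumnOp F n), l.length = S.card ∧
      (∀ o ∈ l, o.src = j₀ ∧ o.tgt ∈ S ∧ o.shift = e) ∧
      ∀ v j, ColumnOp.actList l v j =
        v j + if j ∈ S then LaurentPolynomial.C (c j) * T e * v j₀ else 0 := by
  induction S using Finset.induction_on with
  | empty => exact ⟨[], by simp⟩
  | insert a S ha ih =>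
    have haj : j₀ ≠ a := fun h => hS (by simp [h])
    obtain ⟨l, h1, h2, h3⟩ := ih fun h => hS (Finset.mem_insert_of_mem h)
    refine ⟨⟨j₀, a, haj, c a, e⟩ :: l, by simp [h1, ha], ?_, ?_⟩
    · intro o ho
      rcases List.mem_cons.1 ho with rfl | ho
      · simp
      · exact ⟨(h2 o ho).1, Finset.mem_insert_of_mem (h2 o ho).2.1, (h2 o ho).2.2⟩
    · intro v j
      simp only [ColumnOp.actList_cons, LinearMap.comp_apply, h3]
      by_cases hj : j = a
      · subst hj
        simp [ColumnOp.act_apply, ha]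
      · simp [ColumnOp.act_apply, hj, haj]

/-! ### Saturated submodules and coordinate submodules -/

/-- A submodule with torsion-free quotient. -/
def Saturated (M : Submodule F[T;T⁻¹] (Fin n → F[T;T⁻¹])) : Prop :=
  ∀ (a : F[T;T⁻¹]) (v : Fin n → F[T;T⁻¹]), a ≠ 0 → a • v ∈ M → v ∈ M

theorem Saturated.map {M : Submodule F[T;T⁻¹] (Fin n → F[T;T⁻¹])} (hM : Saturated M)
    {f : (Fin n → F[T;T⁻¹]) →ₗ[F[T;T⁻¹]] (Fin n → F[T;T⁻¹])} (hf : Function.Bijective f) :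
    Saturated (M.map f) := by
  intro a v ha hv
  obtain ⟨w, rfl⟩ := hf.2 v
  rw [← map_smul] at hv
  obtain ⟨u, hu, hue⟩ := hv
  rw [hf.1 hue] at hu
  exact ⟨w, hM a w ha hu, rfl⟩

/-- The submodule of the vectors supported in `I`. -/
def coord (F : Type*) [Field F] {n : ℕ} (I : Finset (Fin n)) :
    Submodule F[T;T⁻¹] (Fin n → F[T;T⁻¹]) where
  carrier := {v | ∀ j, j ∉ I → v j = 0}
  zero_mem' := by simp
  add_mem' := by
    intro a b ha hb j hj
    simp [ha j hj, hb j hj]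
  smul_mem' := by
    intro a v hv j hj
    simp [hv j hj]

theorem mem_coord {I : Finset (Fin n)} {v : Fin n → F[T;T⁻¹]} :
    v ∈ coord F I ↔ ∀ j, j ∉ I → v j = 0 := Iff.rfl

theorem single_mem_coord {I : Finset (Fin n)} {i : Fin n} (hi : i ∈ I) (a : F[T;T⁻¹]) :
    Pi.single i a ∈ coord F I := fun j hj => by
  rw [Pi.single_eq_of_ne]
  rintro rfl
  exact hj hi

theorem coord_le_iff {I : Finset (Fin n)} {M : Submodule F[T;T⁻¹] (Fin n → F[T;T⁻¹])} :
    coord F I ≤ M ↔ ∀ i ∈ I, Pi.single i 1 ∈ M := by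
  constructor
  · exact fun h i hi => h (single_mem_coord hi 1)
  · intro h v hv
    rw [pi_eq_sum_univ' v]
    refine Submodule.sum_mem _ fun i _ => ?_
    by_cases hi : i ∈ I
    · exact Submodule.smul_mem _ _ (h i hi)
    · rw [mem_coord.1 hv i hi, zero_smul]
      exact Submodule.zero_mem _

theorem finrank_coord (I : Finset (Fin n)) : Module.finrank F[T;T⁻¹] (coord F I) = I.card := by
  have hli : LinearIndependent F[T;T⁻¹]
      (fun i : I => (Pi.single (i : Fin n) 1 : Fin n → F[T;T⁻¹])) := by
    convert (Pi.basisFun F[T;T⁻¹] (Fin n)).linearIndependent.comp _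
      (Subtype.val_injective (p := fun i => i ∈ I)) using 1
    funext i
    simp
  have hspan : coord F I = Submodule.span F[T;T⁻¹]
      (Set.range fun i : I => (Pi.single (i : Fin n) 1 : Fin n → F[T;T⁻¹])) := by
    refine le_antisymm (coord_le_iff.2 fun i hi => Submodule.subset_span ⟨⟨i, hi⟩, rfl⟩) ?_
    rw [Submodule.span_le]
    rintro _ ⟨i, rfl⟩
    exact single_mem_coord i.2 1
  rw [hspan, finrank_span_eq_card hli, Fintype.card_coe]

/-- Powers of the variable are units, so a delay left over at the end of a reduction can be dropped.
-/
theorem map_colShift_coord (j₀ : Fin n) (e : ℤ) (I : Finset (Fin n)) :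
    (coord F I).map (colShift j₀ e) = coord F I := by
  refine le_antisymm ?_ ?_
  · rintro _ ⟨v, hv, rfl⟩ j hj
    rw [colShift_apply, hv j hj, mul_zero]
  · intro v hv
    refine ⟨colShift j₀ (-e) v, ?_, by simpa using colShift_neg_apply j₀ (-e) v⟩
    intro j hj
    rw [colShift_apply, hv j hj, mul_zero]

/-- The module generated by the rows of a polynomial matrix and all their shifts. -/
def rowModule {r : ℕ} (H : Fin r → Fin n → F[X]) : Submodule F[T;T⁻¹] (Fin n → F[T;T⁻¹]) :=
  Submodule.span F[T;T⁻¹] (Set.range fun k j => toLaurent (H k j))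

theorem row_mem_rowModule {r : ℕ} (H : Fin r → Fin n → F[X]) (k : Fin r) :
    (fun j => toLaurent (H k j)) ∈ rowModule H := Submodule.subset_span ⟨k, rfl⟩

/-! ### Reduction of a saturated row module to a coordinate submodule -/

/-- A square polynomial matrix whose entries have degree at most `m` and whose coefficient matrix
in degree `m` is the identity has nonzero determinant. -/
theorem det_ne_zero_of_coeff_eq_one {ι : Type*} [Fintype ι] [DecidableEq ι]
    (V : Matrix ι ι F[X]) (m : ℕ) (hdeg : ∀ i j, (V i j).natDegree ≤ m)
    (hcoeff : ∀ i j, (V i j).coeff m = if i = j then 1 else 0) : V.det ≠ 0 := by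
  intro hdet
  obtain ⟨p, hp0, hp⟩ := Matrix.exists_mulVec_eq_zero_iff.2 hdet
  -- In degree `m + e` the product of `V` with the kernel vector `p` has the degree-`e` coefficients
  -- of `p` as entries. They all vanish, although `e` is the largest degree in `p`.
  set e := Finset.univ.sup fun j => (p j).natDegree with he
  have hle : ∀ j, (p j).natDegree ≤ e := fun j =>
    Finset.le_sup (f := fun j => (p j).natDegree) (Finset.mem_univ j)
  have hz : ∀ i, (p i).coeff e = 0 := by
    intro i
    have h := congrArg (fun q : F[X] => q.coeff (m + e)) (congrFun hp i)
    simp only [Matrix.mulVec, dotProduct, Polynomial.finsetSum_coeff, Pi.zero_apply,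
      Polynomial.coeff_zero] at h
    rw [← h, Finset.sum_congr rfl fun j _ =>
      Polynomial.coeff_mul_add_eq_of_natDegree_le (hdeg i j) (hle j)]
    simp [hcoeff]
  obtain ⟨i, hi⟩ := Function.ne_iff.1 hp0
  obtain ⟨j, -, hj⟩ := Finset.exists_mem_eq_sup (Finset.univ : Finset ι) ⟨i, Finset.mem_univ i⟩
    fun j => (p j).natDegree
  have hpj : p j = 0 := by
    rw [← Polynomial.leadingCoeff_eq_zero, Polynomial.leadingCoeff, ← hj]
    exact hz j
  have he0 : e = 0 := by rw [he, hj, hpj, Polynomial.natDegree_zero]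
  apply hi
  have h0 := Polynomial.eq_C_of_natDegree_le_zero (p := p i) (by simpa [he0] using hle i)
  rw [h0, ← he0, hz i]
  simp

/-- If the coefficient matrix in the top degrees has independent columns, then a saturated row
module is everything. -/
theorem rowModule_eq_coord {r : ℕ} (J : Finset (Fin n)) (H : Fin r → Fin n → F[X])
    (d : Fin r → ℕ) (hdeg : ∀ k j, (H k j).natDegree ≤ d k) (hJ : ∀ k j, j ∉ J → H k j = 0)
    (hsat : Saturated (rowModule H))
    (hli : LinearIndependent F fun (j : J) (k : Fin r) => (H k j).coeff (d k)) :
    rowModule H = coord F J := by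
  classical
  refine le_antisymm ?_ ?_
  · rw [rowModule, Submodule.span_le]
    rintro _ ⟨k, rfl⟩ j hj
    simp [hJ k j hj]
  -- Independent columns give the coefficient matrix a left inverse, whose entries are collected in
  -- `Q`.
  obtain ⟨g, hg⟩ := LinearMap.exists_leftInverse_of_injective
    (Fintype.linearCombination F fun (j : J) (k : Fin r) => (H k j).coeff (d k))
    (by
      refine LinearMap.ker_eq_bot'.2 fun a ha => funext ?_
      exact Fintype.linearIndependent_iff.1 hli a
        (by simpa [Fintype.linearCombination_apply] using ha))
  set Q : J → Fin r → F := fun i k => g (Pi.single k 1) i with hQ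
  have hQL : ∀ i j : J, ∑ k, Q i k * (H k j).coeff (d k) = if i = j then 1 else 0 := by
    intro i j
    have h := congrFun (LinearMap.congr_fun hg (Pi.single j 1)) i
    rw [LinearMap.comp_apply, Fintype.linearCombination_apply_single, one_smul,
      pi_eq_sum_univ' (fun k => (H k j).coeff (d k))] at h
    simp only [map_sum, map_smul, Finset.sum_apply, Pi.smul_apply, smul_eq_mul,
      LinearMap.id_apply, Pi.single_apply] at h
    rw [← h]
    exact Finset.sum_congr rfl fun k _ => mul_comm _ _
  set m := ∑ k, d k with hm
  have hdm : ∀ k, d k ≤ m := fun k => Finset.single_le_sum (f := d) (by simp) (Finset.mem_univ k)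
  -- The factors `X ^ (m - d k)` align all top degrees at `m`, so that `Q` makes the coefficient
  -- matrix of `V` in degree `m` the identity.
  set V : J → Fin n → F[X] := fun i j =>
    ∑ k, (Polynomial.C (Q i k) * X ^ (m - d k)) * H k j with hV
  have hVmem : ∀ i, (fun j => toLaurent (V i j)) ∈ rowModule H := by
    intro i
    have : (fun j => toLaurent (V i j)) = ∑ k, toLaurent (Polynomial.C (Q i k) * X ^ (m - d k)) •
        fun j => toLaurent (H k j) := by
      funext j
      simp only [hV, map_sum, Finset.sum_apply, Pi.smul_apply, smul_eq_mul, map_mul]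
    rw [this]
    exact Submodule.sum_mem _ fun k _ => Submodule.smul_mem _ _ (row_mem_rowModule H k)
  have hqdeg : ∀ i k, (Polynomial.C (Q i k) * X ^ (m - d k)).natDegree ≤ m - d k := fun i k =>
    Polynomial.natDegree_C_mul_X_pow_le _ _
  have hdet : (Matrix.of fun i j : J => V i j).det ≠ 0 := by
    refine det_ne_zero_of_coeff_eq_one _ m (fun i j => ?_) fun i j => ?_
    · rw [Matrix.of_apply]
      refine Polynomial.natDegree_sum_le_of_forall_le _ _ fun k _ => ?_
      refine Polynomial.natDegree_mul_le.trans ?_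
      have h1 := hqdeg i k
      have h2 := hdeg k j
      have h3 := hdm k
      omega
    · simp only [hV, Matrix.of_apply, Polynomial.finsetSum_coeff]
      rw [← hQL i j]
      refine Finset.sum_congr rfl fun k _ => ?_
      have := Polynomial.coeff_mul_add_eq_of_natDegree_le (hqdeg i k) (hdeg k j)
      rw [Nat.sub_add_cancel (hdm k)] at this
      rw [this]
      simp
  rw [coord_le_iff]
  intro i hi
  -- Multiplying `V` by its adjugate puts the determinant times each unit vector into the row
  -- module; saturation removes the determinant.
  refine hsat (toLaurent (Matrix.of fun i j : J => V i j).det) _ ?_ ?_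
  · rwa [Ne, Polynomial.toLaurent_eq_zero]
  · have : toLaurent (Matrix.of fun i j : J => V i j).det • (Pi.single i 1 : Fin n → F[T;T⁻¹]) =
        ∑ k : J, toLaurent ((Matrix.of fun i j : J => V i j).adjugate ⟨i, hi⟩ k) •
          fun j => toLaurent (V k j) := by
      funext j
      simp only [Finset.sum_apply, Pi.smul_apply, smul_eq_mul, ← map_mul, ← map_sum]
      by_cases hj : j ∈ J
      · have h := congrFun (congrFun (Matrix.adjugate_mul (Matrix.of fun i j : J => V i j))
          ⟨i, hi⟩) ⟨j, hj⟩
        rw [Matrix.mul_apply] at h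
        simp only [Matrix.of_apply] at h
        rw [h]
        by_cases hij : i = j
        · subst hij; simp
        · simp [hij, Ne.symm hij]
      · have hij : j ≠ i := by rintro rfl; exact hj hi
        simp [hV, hJ _ j hj, hij]
    rw [this]
    exact Submodule.sum_mem _ fun k _ => Submodule.smul_mem _ _ (hVmem k)

/-- `M` can be changed into a coordinate submodule by `N` column operations on the columns in `J`
with shifts of size at most `K`. -/
def Reducible (J : Finset (Fin n)) (N K : ℕ) (M : Submodule F[T;T⁻¹] (Fin n → F[T;T⁻¹])) : Prop :=
  ∃ (l : List (ColumnOp F n)) (I : Finset (Fin n)), I ⊆ J ∧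
    M.map (ColumnOp.actList l) = coord F I ∧ l.length ≤ N ∧
    ∀ o ∈ l, o.src ∈ J ∧ o.tgt ∈ J ∧ |o.shift| ≤ K

theorem Reducible.mono {J J' : Finset (Fin n)} {N N' K K' : ℕ}
    {M : Submodule F[T;T⁻¹] (Fin n → F[T;T⁻¹])} (h : Reducible J N K M) (hJ : J ⊆ J')
    (hN : N ≤ N') (hK : K ≤ K') : Reducible J' N' K' M := by
  obtain ⟨l, I, h1, h2, h3, h4⟩ := h
  refine ⟨l, I, h1.trans hJ, h2, h3.trans hN, fun o ho => ?_⟩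
  obtain ⟨ha, hb, hc⟩ := h4 o ho
  exact ⟨hJ ha, hJ hb, hc.trans (by exact_mod_cast hK)⟩

theorem Reducible.of_map_actList {J : Finset (Fin n)} {N K : ℕ}
    {M : Submodule F[T;T⁻¹] (Fin n → F[T;T⁻¹])} (l : List (ColumnOp F n))
    (hl : ∀ o ∈ l, o.src ∈ J ∧ o.tgt ∈ J ∧ |o.shift| ≤ K)
    (h : Reducible J N K (M.map (ColumnOp.actList l))) : Reducible J (l.length + N) K M := by
  obtain ⟨l', I, h1, h2, h3, h4⟩ := h
  refine ⟨l ++ l', I, h1, ?_, by simpa using h3, fun o ho => ?_⟩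
  · rw [ColumnOp.actList_append, Submodule.map_comp, h2]
  · rcases List.mem_append.1 ho with ho | ho
    · exact hl o ho
    · exact h4 o ho

/-- Undoing the delay after the reduction conjugates every operation by it. The number of operations
stays the same, and each shift changes by at most `|e|` because source and target differ. -/
theorem Reducible.of_map_colShift {J : Finset (Fin n)} {N K : ℕ}
    {M : Submodule F[T;T⁻¹] (Fin n → F[T;T⁻¹])} (j₀ : Fin n) (e : ℤ)
    (h : Reducible J N K (M.map (colShift j₀ e))) : Reducible J N (K + e.natAbs) M := by
  obtain ⟨l, I, h1, h2, h3, h4⟩ := h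
  refine ⟨l.map (ColumnOp.shiftAt j₀ (-e)), I, h1, ?_, by simpa using h3, fun o ho => ?_⟩
  · have h5 : M = (M.map (colShift j₀ e)).map (colShift j₀ (-e)) := by
      rw [← Submodule.map_comp]
      convert (Submodule.map_id M).symm
      exact LinearMap.ext (colShift_neg_apply j₀ e)
    conv_lhs => rw [h5]
    rw [← Submodule.map_comp, ← colShift_comp_actList, Submodule.map_comp, h2, map_colShift_coord]
  · obtain ⟨o', ho', rfl⟩ := List.mem_map.1 ho
    obtain ⟨ha, hb, hc⟩ := h4 o' ho'
    refine ⟨ha, hb, ?_⟩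
    have hne := o'.ne
    simp only [ColumnOp.shiftAt]
    split_ifs with h6 h7
    · exact absurd (h7.trans h6.symm) hne
    all_goals rw [abs_le] at *; rw [Nat.cast_add]; constructor <;> omega

theorem map_rowModule {r : ℕ} (H H' : Fin r → Fin n → F[X])
    (f : (Fin n → F[T;T⁻¹]) →ₗ[F[T;T⁻¹]] (Fin n → F[T;T⁻¹]))
    (h : ∀ k, f (fun j => toLaurent (H k j)) = fun j => toLaurent (H' k j)) :
    (rowModule H).map f = rowModule H' := by
  rw [rowModule, Submodule.map_span, rowModule, ← Set.range_comp]
  congr 2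
  funext k
  exact h k

/-- Multiplying a row by the variable does not change the row module. -/
theorem rowModule_update_X_mul {r : ℕ} (H H' : Fin r → Fin n → F[X]) (k₀ : Fin r)
    (h₀ : ∀ j, H k₀ j = X * H' k₀ j) (h : ∀ k, k ≠ k₀ → H k = H' k) :
    rowModule H = rowModule H' := by
  have hrow : (fun j => toLaurent (H k₀ j)) = (T 1 : F[T;T⁻¹]) • fun j => toLaurent (H' k₀ j) := by
    funext j
    simp [h₀, Polynomial.toLaurent_X]
  have hrow' : (fun j => toLaurent (H' k₀ j)) =
      (T (-1) : F[T;T⁻¹]) • fun j => toLaurent (H k₀ j) := by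
    rw [hrow, smul_smul, ← T_add]
    simp
  refine le_antisymm (Submodule.span_le.2 ?_) (Submodule.span_le.2 ?_)
  · rintro _ ⟨k, rfl⟩
    by_cases hk : k = k₀
    · subst hk
      simp only [SetLike.mem_coe, hrow]
      exact Submodule.smul_mem _ _ (row_mem_rowModule H' k)
    · simp only [SetLike.mem_coe, h k hk]
      exact row_mem_rowModule H' k
  · rintro _ ⟨k, rfl⟩
    by_cases hk : k = k₀
    · subst hk
      simp only [SetLike.mem_coe, hrow']
      exact Submodule.smul_mem _ _ (row_mem_rowModule H k)
    · simp only [SetLike.mem_coe, ← h k hk]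
      exact row_mem_rowModule H k

/-- A dependency between the columns of the coefficient matrix in the top degrees allows to lower
the degrees in one of the columns. -/
theorem exists_ops_lower_degree {r : ℕ} (J : Finset (Fin n)) (H : Fin r → Fin n → F[X])
    (d : Fin r → ℕ) (hdeg : ∀ k j, (H k j).natDegree ≤ d k) (hJ : ∀ k j, j ∉ J → H k j = 0)
    (hli : ¬ LinearIndependent F fun (j : J) (k : Fin r) => (H k j).coeff (d k)) :
    ∃ (l : List (ColumnOp F n)) (j₀ : Fin n) (H' : Fin r → Fin n → F[X]), j₀ ∈ J ∧
      l.length ≤ n ∧ (∀ o ∈ l, o.src ∈ J ∧ o.tgt ∈ J ∧ o.shift = 0) ∧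
      (rowModule H).map (ColumnOp.actList l) = rowModule H' ∧
      (∀ k j, (H' k j).natDegree ≤ d k) ∧ (∀ k j, j ∉ J → H' k j = 0) ∧
      ∀ k, (H' k j₀).coeff (d k) = 0 := by
  classical
  obtain ⟨g, hg, j₀, hj₀⟩ := Fintype.not_linearIndependent_iff.1 hli
  -- The dependency is normalized to have coefficient `1` at `j₀`, so that it becomes an addition of
  -- other columns to column `j₀`.
  set c : Fin n → F := fun i => if h : i ∈ J then g ⟨i, h⟩ / g j₀ else 0 with hc
  have hsum : ∀ k, (H k j₀).coeff (d k) + ∑ i ∈ J.erase j₀, c i * (H k i).coeff (d k) = 0 := by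
    intro k
    have h1 := congrFun hg k
    simp only [Finset.sum_apply, Pi.smul_apply, smul_eq_mul, Pi.zero_apply] at h1
    have h2 : ∑ i ∈ J, c i * (H k i).coeff (d k) = 0 := by
      rw [← Finset.sum_coe_sort]
      have : ∀ i : J, c i * (H k i).coeff (d k) = (g j₀)⁻¹ * (g i * (H k i).coeff (d k)) := by
        intro i
        simp only [hc, i.2, dif_pos]
        ring
      rw [Finset.sum_congr rfl fun i _ => this i, ← Finset.mul_sum, h1, mul_zero]
    rw [← Finset.add_sum_erase J _ j₀.2] at h2
    have h3 : c j₀ = 1 := by simp [hc, hj₀]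
    rwa [h3, one_mul] at h2
  obtain ⟨l, hl1, hl2, hl3⟩ := exists_ops_gather (j₀ : Fin n) 0 c (J.erase j₀) (by simp)
  refine ⟨l, j₀, fun k j => H k j + if j = j₀ then
      ∑ i ∈ J.erase j₀, Polynomial.C (c i) * H k i else 0, j₀.2, ?_, ?_, ?_, ?_, ?_, ?_⟩
  · rw [hl1]
    exact (Finset.card_le_univ _).trans (by simp)
  · intro o ho
    obtain ⟨h1, h2, h3⟩ := hl2 o ho
    exact ⟨Finset.mem_of_mem_erase h1, h2 ▸ j₀.2, h3⟩
  · refine map_rowModule _ _ _ fun k => funext fun j => ?_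
    rw [hl3]
    split_ifs with h
    · simp [map_sum]
    · simp
  · intro k j
    refine Polynomial.natDegree_add_le_of_degree_le (hdeg k j) ?_
    split_ifs
    · exact Polynomial.natDegree_sum_le_of_forall_le _ _ fun i _ =>
        (Polynomial.natDegree_C_mul_le _ _).trans (hdeg k i)
    · simp
  · intro k j hj
    have : j ≠ j₀ := by rintro rfl; exact hj j₀.2
    simp [this, hJ k j hj]
  · intro k
    simpa [Polynomial.finsetSum_coeff] using hsum k

/-- If the degrees in a nonzero column are lower than those allowed for the rows, then the
sum of the row degrees can be reduced. -/
theorem exists_ops_lower_row {r : ℕ} (J : Finset (Fin n)) (H : Fin r → Fin n → F[X])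
    (d : Fin r → ℕ) (hdeg : ∀ k j, (H k j).natDegree ≤ d k) (hJ : ∀ k j, j ∉ J → H k j = 0)
    (j₀ : Fin n) (hj₀ : j₀ ∈ J) (hlow : ∀ k, (H k j₀).coeff (d k) = 0)
    (hne : ∃ k, H k j₀ ≠ 0) :
    ∃ (l : List (ColumnOp F n)) (e : ℤ) (H' : Fin r → Fin n → F[X]) (d' : Fin r → ℕ),
      l.length ≤ n ∧ (∀ o ∈ l, o.src ∈ J ∧ o.tgt ∈ J ∧ o.shift.natAbs ≤ ∑ k, d k) ∧
      e.natAbs ≤ ∑ k, d k ∧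
      ((rowModule H).map (ColumnOp.actList l)).map (colShift j₀ e) = rowModule H' ∧
      (∀ k j, (H' k j).natDegree ≤ d' k) ∧ (∀ k j, j ∉ J → H' k j = 0) ∧
      ∑ k, d' k + 1 = ∑ k, d k := by
  classical
  obtain ⟨k₀, hk₀, hmin⟩ := Finset.exists_min_image
    (Finset.univ.filter fun k => H k j₀ ≠ 0) (fun k => (H k j₀).natTrailingDegree)
    (by obtain ⟨k, hk⟩ := hne; exact ⟨k, by simpa using hk⟩)
  simp only [Finset.mem_filter, Finset.mem_univ, true_and] at hk₀ hmin
  -- `D ^ s` is the largest power of the variable dividing column `j₀`. The quotient column `Q` has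
  -- a nonzero constant term in row `k₀`.
  set s := (H k₀ j₀).natTrailingDegree with hs
  have hdvd : ∀ k, X ^ s ∣ H k j₀ := by
    intro k
    by_cases hk : H k j₀ = 0
    · simp [hk]
    · rw [Polynomial.X_pow_dvd_iff]
      exact fun i hi => Polynomial.coeff_eq_zero_of_lt_natTrailingDegree (hi.trans_le (hmin k hk))
  choose Q hQ using hdvd
  have hb : (Q k₀).coeff 0 ≠ 0 := by
    have h1 : (H k₀ j₀).coeff s ≠ 0 := by
      rw [hs, ← Polynomial.trailingCoeff]
      exact Polynomial.trailingCoeff_nonzero_iff_nonzero.2 hk₀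
    rwa [hQ, Polynomial.coeff_X_pow_mul', if_pos le_rfl, Nat.sub_self] at h1
  -- The vanishing coefficient in degree `d k` makes the degree bound strict, which leaves room for
  -- the factor `X` in `X * Q k`.
  have hQdeg : ∀ k, Q k = 0 ∨ (Q k).natDegree + s + 1 ≤ d k := by
    intro k
    by_cases hk : Q k = 0
    · exact Or.inl hk
    · right
      have h1 : (H k j₀).natDegree = (Q k).natDegree + s := by
        rw [hQ, mul_comm, Polynomial.natDegree_mul_X_pow _ hk]
      have h2 : (H k j₀).natDegree ≠ d k := by
        intro h
        have h3 := hlow k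
        rw [← h, Polynomial.coeff_natDegree, Polynomial.leadingCoeff_eq_zero, hQ] at h3
        exact hk (by simpa using h3)
      have := hdeg k j₀
      omega
  have hQd : ∀ k, (Q k).natDegree ≤ d k ∧ (X * Q k).natDegree ≤ d k := by
    intro k
    rcases hQdeg k with h | h
    · simp [h]
    · have := Polynomial.natDegree_mul_le (p := (X : F[X])) (q := Q k)
      rw [Polynomial.natDegree_X] at this
      omega
  have hsd : s + 1 ≤ d k₀ := by
    rcases hQdeg k₀ with h | h
    · simp [h] at hb
    · omega
  have hd : d k₀ ≤ ∑ k, d k := Finset.single_le_sum (f := d) (by simp) (Finset.mem_univ k₀)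
  -- These multiples of `Q` cancel the constant terms of row `k₀` in the other active columns.
  set c : Fin n → F := fun i => -((H k₀ i).coeff 0 / (Q k₀).coeff 0) with hc
  obtain ⟨l, hl1, hl2, hl3⟩ := exists_ops_spread j₀ (-(s : ℤ)) c (J.erase j₀) (by simp)
  set H₁ : Fin r → Fin n → F[X] := fun k j => if j = j₀ then X * Q k else
    H k j + if j ∈ J.erase j₀ then Polynomial.C (c j) * Q k else 0 with hH₁
  have hH₁deg : ∀ k j, (H₁ k j).natDegree ≤ d k := by
    intro k j
    simp only [hH₁]
    split_ifs
    · exact (hQd k).2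
    · exact Polynomial.natDegree_add_le_of_degree_le (hdeg k j)
        ((Polynomial.natDegree_C_mul_le _ _).trans (hQd k).1)
    · simpa using hdeg k j
  have hH₁J : ∀ k j, j ∉ J → H₁ k j = 0 := by
    intro k j hj
    have : j ≠ j₀ := by rintro rfl; exact hj hj₀
    simp [hH₁, this, hj, hJ k j hj]
  have hH₁0 : ∀ j, (H₁ k₀ j).coeff 0 = 0 := by
    intro j
    by_cases hj : j ∈ J
    · by_cases hjj : j = j₀
      · simp [hH₁, hjj]
      · simp [hH₁, hjj, hj, hc, hb]
    · simp [hH₁J k₀ j hj]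
  have hrow : rowModule H₁ = rowModule (Function.update H₁ k₀ fun j => (H₁ k₀ j).divX) := by
    refine rowModule_update_X_mul _ _ k₀ (fun j => ?_) fun k hk => ?_
    · have := Polynomial.divX_mul_X_add (H₁ k₀ j)
      rw [hH₁0 j, map_zero, add_zero] at this
      rw [Function.update_self, mul_comm, this]
    · rw [Function.update_of_ne hk]
  -- The delay `1 - s` replaces `D ^ s * Q` by `D * Q` in column `j₀`. All of row `k₀` is then
  -- divisible by `D`, and dividing lowers its bound by one; `hsd` ensures that the natural
  -- subtraction does not truncate.
  refine ⟨l, 1 - s, Function.update H₁ k₀ fun j => (H₁ k₀ j).divX,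
    Function.update d k₀ (d k₀ - 1), ?_, ?_, by omega, ?_, ?_, ?_, ?_⟩
  · rw [hl1]
    exact (Finset.card_le_univ _).trans (by simp)
  · intro o ho
    obtain ⟨h1, h2, h3⟩ := hl2 o ho
    exact ⟨h1 ▸ hj₀, Finset.mem_of_mem_erase h2, by rw [h3]; omega⟩
  · rw [← hrow, ← Submodule.map_comp]
    refine map_rowModule _ _ _ fun k => funext fun j => ?_
    rw [LinearMap.comp_apply, colShift_apply, hl3]
    have hT : (T (-(s : ℤ)) : F[T;T⁻¹]) * toLaurent (H k j₀) = toLaurent (Q k) := by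
      rw [hQ, map_mul, Polynomial.toLaurent_X_pow, ← mul_assoc, ← T_add]
      simp
    by_cases hj : j = j₀
    · subst hj
      simp only [hH₁, if_true, Finset.notMem_erase, if_false, add_zero, map_mul,
        Polynomial.toLaurent_X]
      rw [sub_eq_add_neg, T_add, mul_assoc, hT]
    · simp only [hH₁, hj, if_false, one_mul, map_add]
      split_ifs
      · rw [mul_assoc, hT, map_mul, Polynomial.toLaurent_C]
      · simp
  · intro k j
    by_cases hk : k = k₀
    · subst hk
      simp only [Function.update_self, Polynomial.natDegree_divX_eq_natDegree_tsub_one]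
      exact Nat.sub_le_sub_right (hH₁deg k j) 1
    · simpa only [Function.update_of_ne hk] using hH₁deg k j
  · intro k j hj
    by_cases hk : k = k₀
    · subst hk
      simp [hH₁J k j hj]
    · simpa only [Function.update_of_ne hk] using hH₁J k j hj
  · rw [Finset.sum_update_of_mem (Finset.mem_univ k₀),
      ← Finset.add_sum_erase _ d (Finset.mem_univ k₀), Finset.sdiff_singleton_eq_erase]
    omega

/-- A saturated row module can be reduced to a coordinate submodule by a number of column
operations that is polynomial in the number of columns and the sum of the row degrees. -/
theorem reducible_rowModule {r : ℕ} (J : Finset (Fin n)) (H : Fin r → Fin n → F[X])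
    (d : Fin r → ℕ) (hdeg : ∀ k j, (H k j).natDegree ≤ d k) (hJ : ∀ k j, j ∉ J → H k j = 0)
    (hsat : Saturated (rowModule H)) :
    Reducible J (n * J.card + 2 * n * ∑ k, d k) ((∑ k, d k + 1) ^ 2) (rowModule H) := by
  classical
  induction hm : J.card + ∑ k, d k using Nat.strong_induction_on generalizing J H d with
  | _ m ih =>
  by_cases hli : LinearIndependent F fun (j : J) (k : Fin r) => (H k j).coeff (d k)
  · exact ⟨[], J, subset_rfl, by
      rw [rowModule_eq_coord J H d hdeg hJ hsat hli]; exact Submodule.map_id _, by simp, by simp⟩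
  obtain ⟨l, j₀, H', hj₀, hl1, hl2, hmap, hdeg', hJ', hlow⟩ :=
    exists_ops_lower_degree J H d hdeg hJ hli
  have hl2' : ∀ o ∈ l, o.src ∈ J ∧ o.tgt ∈ J ∧ |o.shift| ≤ (((∑ k, d k + 1) ^ 2 : ℕ) : ℤ) := by
    intro o ho
    obtain ⟨h1, h2, h3⟩ := hl2 o ho
    refine ⟨h1, h2, ?_⟩
    rw [h3, abs_zero]
    positivity
  have hsat' : Saturated (rowModule H') := hmap ▸ hsat.map (ColumnOp.actList_bijective l)
  by_cases hne : ∃ k, H' k j₀ ≠ 0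
  · obtain ⟨l', e, H'', d', hl1', hl2'', he, hmap', hdeg'', hJ'', hd'⟩ :=
      exists_ops_lower_row J H' d hdeg' hJ' j₀ hj₀ hlow hne
    have hsat'' : Saturated (rowModule H'') :=
      hmap' ▸ (hsat'.map (ColumnOp.actList_bijective l')).map (colShift_bijective j₀ e)
    have hred := ih (J.card + ∑ k, d' k) (by omega) J H'' d' hdeg'' hJ'' hsat'' rfl
    rw [← hmap'] at hred
    -- Each descent step adds at most the current degree sum to the shifts; the square absorbs these
    -- contributions.
    have hred1 := (hred.of_map_colShift j₀ e).mono (K' := (∑ k, d k + 1) ^ 2) subset_rfl le_rfl (by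
      rw [← hd'] at he ⊢
      have : (∑ k, d' k + 1 + 1) ^ 2 = (∑ k, d' k + 1) ^ 2 + 2 * ∑ k, d' k + 3 := by ring
      omega)
    have hred2 := hred1.of_map_actList l' fun o ho => by
      obtain ⟨h1, h2, h3⟩ := hl2'' o ho
      refine ⟨h1, h2, ?_⟩
      rw [Int.abs_eq_natAbs]
      have : o.shift.natAbs ≤ (∑ k, d k + 1) ^ 2 := by nlinarith
      exact_mod_cast this
    rw [← hmap] at hred2
    refine (hred2.of_map_actList l hl2').mono subset_rfl ?_ le_rfl
    rw [← hd']
    nlinarith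
  -- Column `j₀` has become zero and leaves the active set.
  · push Not at hne
    have hcard := Finset.card_erase_add_one hj₀
    have hred := ih ((J.erase j₀).card + ∑ k, d k) (by omega) (J.erase j₀) H' d hdeg' (by
      intro k j hj
      by_cases hjj : j = j₀
      · exact hjj ▸ hne k
      · exact hJ' k j fun h => hj (Finset.mem_erase.2 ⟨hjj, h⟩)) hsat' rfl
    have hred1 := hred.mono (Finset.erase_subset _ _) le_rfl le_rfl
    rw [← hmap] at hred1
    refine (hred1.of_map_actList l hl2').mono subset_rfl ?_ le_rfl
    rw [← hcard]
    nlinarith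

/-! ### Clearing denominators, and saturation from non-catastrophicity -/

/-- Finitely many Laurent polynomials have a common denominator. -/
theorem exists_toLaurent_eq_T_mul {ι : Type*} [Fintype ι] (f : ι → F[T;T⁻¹]) :
    ∃ (N : ℕ) (p : ι → F[X]), ∀ i, toLaurent (p i) = T N * f i := by
  choose m p hp using fun i => LaurentPolynomial.exists_T_pow (f i)
  refine ⟨∑ i, m i, fun i => X ^ (∑ i, m i - m i) * p i, fun i => ?_⟩
  have hi : m i ≤ ∑ i, m i := Finset.single_le_sum (f := m) (by simp) (Finset.mem_univ i)
  rw [map_mul, Polynomial.toLaurent_X_pow, hp, mul_comm (f i), ← mul_assoc, ← T_add,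
    ← Nat.cast_add, Nat.sub_add_cancel hi]

/-- Up to a power of the variable, a nonzero Laurent polynomial is a polynomial with nonzero
constant term. -/
theorem exists_toLaurent_mul_T {a : F[T;T⁻¹]} (ha : a ≠ 0) :
    ∃ (q : F[X]) (t : ℤ), q.coeff 0 ≠ 0 ∧ toLaurent q = T t * a := by
  obtain ⟨N, p, hp⟩ := LaurentPolynomial.exists_T_pow a
  have hp0 : p ≠ 0 := by
    rintro rfl
    rw [map_zero] at hp
    exact ha (((LaurentPolynomial.isUnit_T (R := F) (N : ℤ)).mul_left_eq_zero).1 hp.symm)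
  have hdvd : X ^ p.natTrailingDegree ∣ p := Polynomial.X_pow_dvd_iff.2 fun i hi =>
    Polynomial.coeff_eq_zero_of_lt_natTrailingDegree hi
  obtain ⟨q, hq⟩ := hdvd
  refine ⟨q, N - p.natTrailingDegree, ?_, ?_⟩
  · have h1 : p.coeff p.natTrailingDegree ≠ 0 := Polynomial.trailingCoeff_nonzero_iff_nonzero.2 hp0
    generalize p.natTrailingDegree = s at *
    rwa [hq, Polynomial.coeff_X_pow_mul', if_pos le_rfl, Nat.sub_self] at h1
  · generalize p.natTrailingDegree = s at *
    rw [hq, map_mul, Polynomial.toLaurent_X_pow] at hp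
    rw [sub_eq_neg_add, T_add, mul_assoc, mul_comm (T _) a, ← hp, ← mul_assoc, ← T_add]
    simp

/-- The row module of a non-catastrophic encoder is saturated. -/
theorem NonCatastrophic.saturated {r : ℕ} {H : Matrix (Fin r) (Fin n) F[X]}
    (hH : NonCatastrophic H) : Saturated (rowModule H) := by
  intro a v ha hv
  -- Up to a unit, the scalar is a polynomial with nonzero constant term, hence invertible as a
  -- power series.
  obtain ⟨q, t, hq0, hq⟩ := exists_toLaurent_mul_T ha
  have hqv : toLaurent q • v ∈ rowModule H := by
    rw [hq, mul_smul]
    exact Submodule.smul_mem _ _ hv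
  obtain ⟨u, hu⟩ := (Submodule.mem_span_range_iff_exists_fun _).1 hqv
  obtain ⟨N, p, hp⟩ := exists_toLaurent_eq_T_mul (Sum.elim u v)
  have hpu : ∀ k, toLaurent (p (Sum.inl k)) = T N * u k := fun k => hp (Sum.inl k)
  have hpv : ∀ j, toLaurent (p (Sum.inr j)) = T N * v j := fun j => hp (Sum.inr j)
  have hpoly : ∀ j, ∑ k, p (Sum.inl k) * H k j = q * p (Sum.inr j) := by
    intro j
    apply Polynomial.toLaurent_injective
    have h := congrFun hu j
    simp only [Finset.sum_apply, Pi.smul_apply, smul_eq_mul] at h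
    simp only [map_sum, map_mul, hpu, hpv, mul_assoc, ← Finset.mul_sum, h]
    ring
  have hqinv : (q : PowerSeries F) * (q : PowerSeries F)⁻¹ = 1 :=
    PowerSeries.mul_inv_cancel _ (by simpa using hq0)
  have hps : ∀ j, ∑ k, ((p (Sum.inl k) : PowerSeries F) * (q : PowerSeries F)⁻¹) *
      (H k j : PowerSeries F) = (p (Sum.inr j) : PowerSeries F) := by
    intro j
    have h := congrArg (fun f : F[X] => (f : PowerSeries F)) (hpoly j)
    simp only [← Polynomial.coeToPowerSeries.ringHom_apply, map_sum, map_mul] at h ⊢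
    rw [← Polynomial.coeToPowerSeries.ringHom_apply] at hqinv
    simp only [mul_right_comm _ (_⁻¹ : PowerSeries F), ← Finset.sum_mul, h]
    rw [mul_right_comm, hqinv, one_mul]
  -- The quotient of the information stream by `q` is a priori only a power series. Its code stream
  -- is polynomial, so non-catastrophicity makes it polynomial.
  choose w hw using hH _ fun j => ⟨_, hps j⟩
  have hfin : ∀ j, ∑ k, w k * H k j = p (Sum.inr j) := by
    intro j
    apply Polynomial.coe_injective F
    have h := hps j
    simp only [hw] at h
    simp only [← Polynomial.coeToPowerSeries.ringHom_apply, map_sum, map_mul] at h ⊢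
    exact h
  have hv' : v = (T (-(N : ℤ)) : F[T;T⁻¹]) • ∑ k, toLaurent (w k) • fun j => toLaurent (H k j) := by
    funext j
    simp only [Finset.sum_apply, Pi.smul_apply, smul_eq_mul, ← map_mul, ← map_sum, hfin, hpv]
    rw [← mul_assoc, ← T_add]
    simp
  rw [hv']
  exact Submodule.smul_mem _ _ (Submodule.sum_mem _ fun k _ =>
    Submodule.smul_mem _ _ (row_mem_rowModule H k))

/-! ### Depth -/

theorem RunsInTime.append {g₁ g₂ : List (QuditGate F n)} {d₁ d₂ : ℕ} (h₁ : RunsInTime g₁ d₁)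
    (h₂ : RunsInTime g₂ d₂) : RunsInTime (g₁ ++ g₂) (d₁ + d₂) := by
  obtain ⟨τ₁, h₁⟩ := h₁
  obtain ⟨τ₂, h₂⟩ := h₂
  have hlen : ∀ a : Fin (g₁ ++ g₂).length, ¬ (a : ℕ) < g₁.length →
      (a : ℕ) - g₁.length < g₂.length := by
    intro a ha
    have := a.2
    simp only [List.length_append] at this
    omega
  refine ⟨fun a => if h : (a : ℕ) < g₁.length then Fin.castAdd d₂ (τ₁ ⟨a, h⟩)
    else Fin.natAdd d₁ (τ₂ ⟨a - g₁.length, hlen a h⟩), fun a b hab hd => ?_⟩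
  have hab' : (a : ℕ) < b := hab
  by_cases hb : (b : ℕ) < g₁.length
  · have ha : (a : ℕ) < g₁.length := hab'.trans hb
    have := h₁ ⟨a, ha⟩ ⟨b, hb⟩ hab' (by
      simpa [List.getElem_append_left ha, List.getElem_append_left hb] using hd)
    simpa only [ha, hb, dif_pos, Fin.lt_def, Fin.val_castAdd] using this
  · by_cases ha : (a : ℕ) < g₁.length
    · simp only [ha, hb, dif_pos, dif_neg, not_false_iff]
      rw [Fin.lt_def, Fin.val_castAdd, Fin.val_natAdd]
      omega
    · have := h₂ ⟨a - g₁.length, hlen a ha⟩ ⟨b - g₁.length, hlen b hb⟩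
        (by simp only [Fin.mk_lt_mk]; omega) (by
        simpa [List.getElem_append_right (not_lt.1 ha), List.getElem_append_right (not_lt.1 hb)]
          using hd)
      simpa [ha, hb] using this

theorem RunsInTime.of_pairwise {g : List (QuditGate F n)}
    (h : g.Pairwise fun a b => Disjoint a.support b.support) : RunsInTime g 1 :=
  ⟨fun _ => 0, fun a b hab hd => absurd (List.pairwise_iff_get.1 h a b hab) hd⟩

theorem framePositions_pairwise (N : ℕ) (ℓ : ℤ) :
    (framePositions N ℓ).Pairwise fun s t => s ≠ t := by
  refine List.Pairwise.filter _ ?_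
  have h : ((List.range N).map fun t : ℕ => (t : ℤ)).Nodup :=
    List.Nodup.map (fun _ _ h => Int.ofNat_inj.1 h) List.nodup_range
  simpa [List.bind_eq_flatMap, ← List.map_eq_flatMap, List.Nodup, Function.comp_def] using h

/-- Gates other than the controlled phase gate. -/
def Gate.IsParallel : Gate F n → Prop
  | .cphase _ _ _ => False
  | _ => True

/-- Distinct frames give disjoint supports. For ADD this uses `i ≠ j`: a source of one copy is never
a target of another, even across frames. -/
theorem Gate.IsParallel.runsInTime {g : Gate F n} (hg : g.IsParallel) (N : ℕ) :
    RunsInTime (g.unroll N) 1 := by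
  refine RunsInTime.of_pairwise ?_
  cases g with
  | dft i =>
    exact (framePositions_pairwise N 0).map _ fun s t hst => by simp [QuditGate.support, hst]
  | mult i γ =>
    exact (framePositions_pairwise N 0).map _ fun s t hst => by simp [QuditGate.support, hst]
  | phase i γ =>
    exact (framePositions_pairwise N 0).map _ fun s t hst => by simp [QuditGate.support, hst]
  | add i j ℓ h =>
    exact (framePositions_pairwise N ℓ).map _ fun s t hst => by
      simp [QuditGate.support, hst.symm, h, h.symm]
  | cphase i ℓ h => exact hg.elim

theorem Circuit.depth_le_length {c : Circuit F n} (hc : ∀ g ∈ c, g.IsParallel) (N : ℕ) :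
    Circuit.depth c N ≤ c.length := by
  refine Nat.sInf_le ?_
  show RunsInTime (Circuit.unroll N c) c.length
  induction c with
  | nil =>
    exact ⟨fun a => absurd a.2 (by simp [Circuit.unroll]),
      fun a => absurd a.2 (by simp [Circuit.unroll])⟩
  | cons g c ih =>
    rw [List.length_cons, add_comm]
    exact ((hc g (by simp)).runsInTime N).append (ih fun g' hg' => hc g' (by simp [hg']))

/-! ### The action of circuits -/

/-- The action of a circuit on vectors `(X(D) | Z(D))`. -/
def Circuit.act (c : Circuit F n) :
    (Fin n ⊕ Fin n → F[T;T⁻¹]) →ₗ[F[T;T⁻¹]] (Fin n ⊕ Fin n → F[T;T⁻¹]) :=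
  (Circuit.matrix c).vecMulLinear

theorem Circuit.act_append (c₁ c₂ : Circuit F n) :
    Circuit.act (c₁ ++ c₂) = Circuit.act c₂ ∘ₗ Circuit.act c₁ := by
  refine LinearMap.ext fun v => ?_
  simp [Circuit.act, Circuit.matrix]

theorem Circuit.act_nil : Circuit.act ([] : Circuit F n) = LinearMap.id := by
  refine LinearMap.ext fun v => ?_
  simp [Circuit.act, Circuit.matrix]

theorem Circuit.act_cons_apply (g : Gate F n) (c : Circuit F n) (v : Fin n ⊕ Fin n → F[T;T⁻¹]) :
    Circuit.act (g :: c) v = Circuit.act c (Matrix.vecMul v g.matrix) := by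
  simp [Circuit.act, Circuit.matrix]

theorem stabilizerSpan_mul_matrix {ρ : Type*} (S : Matrix ρ (Fin n ⊕ Fin n) F[T;T⁻¹])
    (c : Circuit F n) :
    stabilizerSpan (S * Circuit.matrix c) = (stabilizerSpan S).map (Circuit.act c) := by
  rw [stabilizerSpan, stabilizerSpan, Submodule.map_span, ← Set.range_comp]
  rfl

theorem vecMul_singleQudit_inl (i : Fin n) (a b c d : F[T;T⁻¹]) (v : Fin n ⊕ Fin n → F[T;T⁻¹])
    (j : Fin n) : Matrix.vecMul v (singleQudit i a b c d) (Sum.inl j) =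
      if j = i then v (Sum.inl i) * a + v (Sum.inr i) * c else v (Sum.inl j) := by
  by_cases h : j = i
  · subst h
    simp [singleQudit, Matrix.vecMul, dotProduct, Matrix.diagonal_apply, Matrix.single_apply]
  · simp [singleQudit, Matrix.vecMul, dotProduct, Matrix.diagonal_apply, h, Ne.symm h]

theorem vecMul_singleQudit_inr (i : Fin n) (a b c d : F[T;T⁻¹]) (v : Fin n ⊕ Fin n → F[T;T⁻¹])
    (j : Fin n) : Matrix.vecMul v (singleQudit i a b c d) (Sum.inr j) =
      if j = i then v (Sum.inl i) * b + v (Sum.inr i) * d else v (Sum.inr j) := by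
  by_cases h : j = i
  · subst h
    simp [singleQudit, Matrix.vecMul, dotProduct, Matrix.diagonal_apply, Matrix.single_apply]
  · simp [singleQudit, Matrix.vecMul, dotProduct, Matrix.diagonal_apply, h, Ne.symm h]

theorem vecMul_add_inl (i j : Fin n) (ℓ : ℤ) (h : i ≠ j) (v : Fin n ⊕ Fin n → F[T;T⁻¹])
    (k : Fin n) : Matrix.vecMul v (Gate.add i j ℓ h).matrix (Sum.inl k) =
      v (Sum.inl k) + if k = j then v (Sum.inl i) * T ℓ else 0 := by
  by_cases hk : k = j
  · subst hk
    simp [Gate.matrix, Matrix.vecMul, dotProduct, Matrix.single_apply, Matrix.one_apply, mul_add,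
      Finset.sum_add_distrib]
  · simp [Gate.matrix, Matrix.vecMul, dotProduct, Matrix.one_apply, hk, Ne.symm hk]

theorem vecMul_add_inr (i j : Fin n) (ℓ : ℤ) (h : i ≠ j) (v : Fin n ⊕ Fin n → F[T;T⁻¹])
    (k : Fin n) : Matrix.vecMul v (Gate.add i j ℓ h).matrix (Sum.inr k) =
      v (Sum.inr k) - if k = i then v (Sum.inr j) * T (-ℓ) else 0 := by
  by_cases hk : k = i
  · subst hk
    simp [Gate.matrix, Matrix.vecMul, dotProduct, Matrix.single_apply, Matrix.one_apply, mul_sub,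
      Finset.sum_sub_distrib]
  · simp [Gate.matrix, Matrix.vecMul, dotProduct, Matrix.one_apply, hk, Ne.symm hk]

theorem vecMul_mult_inl (i : Fin n) (γ : Fˣ) (v : Fin n ⊕ Fin n → F[T;T⁻¹]) (k : Fin n) :
    Matrix.vecMul v (Gate.mult i γ).matrix (Sum.inl k) =
      v (Sum.inl k) * if k = i then LaurentPolynomial.C ((γ⁻¹ : Fˣ) : F) else 1 := by
  rw [Gate.matrix, vecMul_singleQudit_inl]
  split_ifs with h
  · rw [h, mul_zero, add_zero]
  · rw [mul_one]

theorem vecMul_mult_inr (i : Fin n) (γ : Fˣ) (v : Fin n ⊕ Fin n → F[T;T⁻¹]) (k : Fin n) :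
    Matrix.vecMul v (Gate.mult i γ).matrix (Sum.inr k) =
      v (Sum.inr k) * if k = i then LaurentPolynomial.C (γ : F) else 1 := by
  rw [Gate.matrix, vecMul_singleQudit_inr]
  split_ifs with h
  · rw [h, mul_zero, zero_add]
  · rw [mul_one]

open Classical in
/-- A circuit that performs a column operation on the `X`-part. -/
def ColumnOp.circuit (o : ColumnOp F n) : Circuit F n :=
  -- The first gate scales `X` at the source by the coefficient, since `mult` acts there by the
  -- inverse of its parameter; the last gate undoes this. A zero coefficient is not a unit, but
  -- requires no gate.
  if h : o.coeff = 0 then [] else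
    [.mult o.src (Units.mk0 o.coeff h)⁻¹, .add o.src o.tgt o.shift o.ne,
      .mult o.src (Units.mk0 o.coeff h)]

theorem ColumnOp.length_circuit_le (o : ColumnOp F n) : o.circuit.length ≤ 3 := by
  unfold ColumnOp.circuit
  split_ifs <;> simp

theorem ColumnOp.isParallel_circuit (o : ColumnOp F n) : ∀ g ∈ o.circuit, g.IsParallel := by
  unfold ColumnOp.circuit
  split_ifs <;> simp [Gate.IsParallel]

theorem ColumnOp.act_circuit_inl (o : ColumnOp F n) (v : Fin n ⊕ Fin n → F[T;T⁻¹]) :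
    Circuit.act o.circuit v ∘ Sum.inl = o.act (v ∘ Sum.inl) := by
  funext k
  have hne := o.ne
  rw [ColumnOp.act_apply, Function.comp_apply]
  unfold ColumnOp.circuit
  by_cases h : o.coeff = 0
  · simp [Circuit.act_nil, h]
  have hC : (LaurentPolynomial.C o.coeff : F[T;T⁻¹]) * LaurentPolynomial.C o.coeff⁻¹ = 1 := by
    rw [← map_mul, mul_inv_cancel₀ h, map_one]
  simp only [h, dif_neg, not_false_iff, Circuit.act_cons_apply, Circuit.act_nil,
    LinearMap.id_apply, vecMul_mult_inl, vecMul_add_inl, _root_.inv_inv, Units.val_mk0,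
    Units.val_inv_eq_inv_val, Function.comp_apply, if_true]
  by_cases hk : k = o.tgt
  · simp only [hk, hne.symm, if_true, if_false]
    ring
  · by_cases hs : k = o.src
    · subst hs
      simp only [hk, if_true, if_false, add_zero]
      linear_combination v (Sum.inl o.src) * hC
    · simp [hk, hs]

theorem ColumnOp.act_circuit_inr (o : ColumnOp F n) (v : Fin n ⊕ Fin n → F[T;T⁻¹]) :
    Circuit.act o.circuit v ∘ Sum.inr = o.dual.act (v ∘ Sum.inr) := by
  funext k
  have hne := o.ne
  rw [ColumnOp.act_apply, Function.comp_apply]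
  unfold ColumnOp.circuit
  by_cases h : o.coeff = 0
  · simp [Circuit.act_nil, h, ColumnOp.dual]
  have hC : (LaurentPolynomial.C o.coeff : F[T;T⁻¹]) * LaurentPolynomial.C o.coeff⁻¹ = 1 := by
    rw [← map_mul, mul_inv_cancel₀ h, map_one]
  simp only [h, dif_neg, not_false_iff, Circuit.act_cons_apply, Circuit.act_nil,
    LinearMap.id_apply, vecMul_mult_inr, vecMul_add_inr, Units.val_mk0, ColumnOp.dual,
    Units.val_inv_eq_inv_val, Function.comp_apply]
  by_cases hs : k = o.src
  · subst hs
    simp only [hne.symm, if_true, if_false, map_neg]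
    linear_combination v (Sum.inr o.src) * hC
  · simp [hs]

/-- A circuit that performs a list of column operations on the `X`-part. -/
def ColumnOp.circuitList (l : List (ColumnOp F n)) : Circuit F n := l.flatMap ColumnOp.circuit

theorem ColumnOp.length_circuitList_le (l : List (ColumnOp F n)) :
    (circuitList l).length ≤ 3 * l.length := by
  induction l with
  | nil => simp [circuitList]
  | cons o l ih =>
    have h := o.length_circuit_le
    simp only [circuitList, List.flatMap_cons, List.length_append, List.length_cons] at ih ⊢
    omega

theorem ColumnOp.isParallel_circuitList (l : List (ColumnOp F n)) :
    ∀ g ∈ circuitList l, g.IsParallel := by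
  intro g hg
  obtain ⟨o, -, ho⟩ := List.mem_flatMap.1 hg
  exact o.isParallel_circuit g ho

theorem ColumnOp.act_circuitList (l : List (ColumnOp F n)) (v : Fin n ⊕ Fin n → F[T;T⁻¹]) :
    Circuit.act (circuitList l) v ∘ Sum.inl = actList l (v ∘ Sum.inl) ∧
      Circuit.act (circuitList l) v ∘ Sum.inr = actList (l.map dual) (v ∘ Sum.inr) := by
  induction l generalizing v with
  | nil => simp [circuitList, Circuit.act_nil]
  | cons o l ih =>
    have h : circuitList (o :: l) = o.circuit ++ circuitList l := rfl
    rw [h, Circuit.act_append, LinearMap.comp_apply, (ih _).1, (ih _).2, o.act_circuit_inl,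
      o.act_circuit_inr]
    simp

/-! ### Stabilizers of CSS type -/

/-- The vectors `(X(D) | Z(D))` with `X`-part in `P` and `Z`-part in `Q`. -/
def cssModule (P Q : Submodule F[T;T⁻¹] (Fin n → F[T;T⁻¹])) :
    Submodule F[T;T⁻¹] (Fin n ⊕ Fin n → F[T;T⁻¹]) :=
  P.comap (LinearMap.funLeft F[T;T⁻¹] F[T;T⁻¹] Sum.inl) ⊓
    Q.comap (LinearMap.funLeft F[T;T⁻¹] F[T;T⁻¹] Sum.inr)

/-- The two halves are transformed independently, so preimages of the `X`-part and of the `Z`-part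
can be chosen separately and joined. -/
theorem map_circuitList_cssModule (l : List (ColumnOp F n))
    (P Q : Submodule F[T;T⁻¹] (Fin n → F[T;T⁻¹])) :
    (cssModule P Q).map (Circuit.act (ColumnOp.circuitList l)) =
      cssModule (P.map (ColumnOp.actList l)) (Q.map (ColumnOp.actList (l.map ColumnOp.dual))) := by
  ext w
  constructor
  · rintro ⟨v, hv, rfl⟩
    obtain ⟨h1, h2⟩ := ColumnOp.act_circuitList l v
    exact ⟨⟨_, hv.1, h1.symm⟩, ⟨_, hv.2, h2.symm⟩⟩
  · rintro ⟨⟨x, hx, hx'⟩, ⟨z, hz, hz'⟩⟩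
    obtain ⟨h1, h2⟩ := ColumnOp.act_circuitList l (Sum.elim x z)
    refine ⟨Sum.elim x z, ⟨hx, hz⟩, ?_⟩
    rw [Sum.elim_comp_inl] at h1
    rw [Sum.elim_comp_inr] at h2
    funext i
    cases i with
    | inl i => exact (congrFun h1 i).trans (congrFun hx' i)
    | inr i => exact (congrFun h2 i).trans (congrFun hz' i)

theorem stabilizerSpan_cssStabilizer {r₁ k₂ : ℕ} (H₁ : Matrix (Fin r₁) (Fin n) F[X])
    (H₂ : Matrix (Fin k₂) (Fin n) F[X]) :
    stabilizerSpan ((cssStabilizer H₁ H₂).map toLaurent) =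
      cssModule (rowModule H₂) (rowModule H₁) := by
  refine le_antisymm ?_ ?_
  · rw [stabilizerSpan, Submodule.span_le]
    rintro _ ⟨k | k, rfl⟩
    · refine ⟨?_, ?_⟩
      · exact row_mem_rowModule H₂ k
      · rw [SetLike.mem_coe, Submodule.mem_comap]
        convert Submodule.zero_mem _ using 1
        funext j
        simp [cssStabilizer, LinearMap.funLeft]
    · refine ⟨?_, ?_⟩
      · rw [SetLike.mem_coe, Submodule.mem_comap]
        convert Submodule.zero_mem _ using 1
        funext j
        simp [cssStabilizer, LinearMap.funLeft]
      · exact row_mem_rowModule H₁ k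
  · rintro v ⟨hx, hz⟩
    obtain ⟨a, ha⟩ := (Submodule.mem_span_range_iff_exists_fun _).1 hx
    obtain ⟨b, hb⟩ := (Submodule.mem_span_range_iff_exists_fun _).1 hz
    refine (Submodule.mem_span_range_iff_exists_fun _).2 ⟨Sum.elim a b, ?_⟩
    funext i
    cases i with
    | inl i =>
      have := congrFun ha i
      simpa [cssStabilizer, LinearMap.funLeft] using this
    | inr i =>
      have := congrFun hb i
      simpa [cssStabilizer, LinearMap.funLeft] using this

theorem stabilizerSpan_trivialStabilizer (r : ℕ) :
    stabilizerSpan (trivialStabilizer F n r) =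
      cssModule ⊥ (coord F (Finset.univ.filter fun j : Fin n => (j : ℕ) < r)) := by
  refine le_antisymm ?_ ?_
  · rw [stabilizerSpan, Submodule.span_le]
    rintro _ ⟨k, rfl⟩
    refine ⟨?_, ?_⟩
    · rw [SetLike.mem_coe, Submodule.mem_comap, Submodule.mem_bot]
      funext j
      simp [trivialStabilizer, LinearMap.funLeft]
    · intro j hj
      have : (k : ℕ) ≠ j := by
        have := k.2
        simp only [Finset.mem_filter, Finset.mem_univ, true_and, not_lt] at hj
        omega
      simp [trivialStabilizer, LinearMap.funLeft, this]
  · rintro v ⟨hx, hz⟩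
    -- If `r` exceeds `n`, the rows with index at least `n` are zero, so their coefficients may be
    -- set to `0`.
    refine (Submodule.mem_span_range_iff_exists_fun _).2
      ⟨fun k => if h : (k : ℕ) < n then v (Sum.inr ⟨k, h⟩) else 0, ?_⟩
    funext i
    cases i with
    | inl i =>
      have := congrFun ((Submodule.mem_bot F[T;T⁻¹]).1 hx) i
      simp only [LinearMap.funLeft_apply, Pi.zero_apply] at this
      simp only [Finset.sum_apply, Pi.smul_apply, smul_eq_mul, trivialStabilizer, Matrix.of_apply,
        Sum.elim_inl, mul_zero, Finset.sum_const_zero, this]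
    | inr i =>
      simp only [Finset.sum_apply, Pi.smul_apply, smul_eq_mul, trivialStabilizer, Matrix.of_apply,
        Sum.elim_inr]
      by_cases hi : (i : ℕ) < r
      · rw [Finset.sum_eq_single ⟨i, hi⟩]
        · simp
        · intro k _ hk
          have : (k : ℕ) ≠ i := fun h => hk (Fin.ext h)
          simp [this]
        · simp
      · have h0 : v (Sum.inr i) = 0 := hz i (by simpa using hi)
        rw [h0]
        refine Finset.sum_eq_zero fun k _ => ?_
        have : (k : ℕ) ≠ i := by
          have := k.2
          omega
        simp [this]

/-- Coordinate submodules of the same rank are related by few column operations. -/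
theorem exists_ops_map_coord (A B : Finset (Fin n)) (h : A.card = B.card) :
    ∃ l : List (ColumnOp F n), l.length ≤ 2 * (A \ B).card ∧
      (coord F A).map (ColumnOp.actList l) = coord F B := by
  classical
  induction hm : (A \ B).card generalizing A with
  | zero =>
    have hAB : A ⊆ B := by
      rwa [Finset.card_eq_zero, Finset.sdiff_eq_empty_iff_subset] at hm
    rw [Finset.eq_of_subset_of_card_le hAB h.ge]
    exact ⟨[], by simp, Submodule.map_id _⟩
  | succ m ih =>
    obtain ⟨a, ha⟩ : (A \ B).Nonempty := Finset.card_pos.1 (by omega)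
    obtain ⟨b, hb⟩ : (B \ A).Nonempty := by
      rw [← Finset.card_pos, ← Finset.card_sdiff_comm h]
      omega
    rw [Finset.mem_sdiff] at ha hb
    have hab : a ≠ b := by rintro rfl; exact hb.2 ha.1
    have hcard : (insert b (A.erase a)).card = B.card := by
      rw [Finset.card_insert_of_notMem (fun h => hb.2 (Finset.mem_of_mem_erase h)),
        Finset.card_erase_add_one ha.1, h]
    have hsd : insert b (A.erase a) \ B = (A \ B).erase a := by
      rw [Finset.insert_sdiff_of_mem _ hb.1]
      ext x
      simp only [Finset.mem_sdiff, Finset.mem_erase]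
      tauto
    obtain ⟨l, hl1, hl2⟩ := ih (insert b (A.erase a)) hcard (by
      rw [hsd, Finset.card_erase_of_mem (Finset.mem_sdiff.2 ha), hm, Nat.add_sub_cancel])
    -- Since coordinate `b` vanishes on the module, two additions suffice to move coordinate `a`
    -- there: copy it to `b`, then clear `a`.
    refine ⟨⟨a, b, hab, 1, 0⟩ :: ⟨b, a, hab.symm, -1, 0⟩ :: l, ?_, ?_⟩
    · simp only [List.length_cons]
      omega
    · rw [ColumnOp.actList_cons, ColumnOp.actList_cons, Submodule.map_comp, Submodule.map_comp,
        ← hl2]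
      congr 1
      refine le_antisymm ?_ ?_
      · rintro _ ⟨_, ⟨v, hv, rfl⟩, rfl⟩ j hj
        have hvb : v b = 0 := hv b hb.2
        simp only [Finset.mem_insert, Finset.mem_erase, not_or, not_and] at hj
        by_cases hja : j = a
        · subst hja
          simp [ColumnOp.act_apply, hab, hvb]
        · simp [ColumnOp.act_apply, hja, hj.1, hv j (hj.2 hja)]
      · intro w hw
        have hwa : w a = 0 := hw a (by simp [hab])
        refine ⟨_, ⟨Function.update (Function.update w b 0) a (w b), ?_, rfl⟩, ?_⟩
        · intro j hj
          have hja : j ≠ a := by rintro rfl; exact hj ha.1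
          rw [Function.update_of_ne hja]
          by_cases hjb : j = b
          · subst hjb; simp
          · rw [Function.update_of_ne hjb]
            exact hw j (by simp [hjb, hj])
        · funext j
          by_cases hja : j = a
          · subst hja
            simp [ColumnOp.act_apply, hab, hab.symm, hwa]
          · by_cases hjb : j = b
            · subst hjb
              simp [ColumnOp.act_apply, hja]
            · simp [ColumnOp.act_apply, hja, hjb]

/-- Fourier transforms exchange `Z`-coordinates for `X`-coordinates. -/
theorem exists_circuit_dft (A I J : Finset (Fin n)) (hA : Disjoint A J) (hI : Disjoint I J) :
    ∃ c : Circuit F n, c.length = J.card ∧ (∀ g ∈ c, g.IsParallel) ∧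
      (cssModule (coord F A) (coord F (I ∪ J))).map (Circuit.act c) =
        cssModule (coord F (A ∪ J)) (coord F I) := by
  classical
  induction J using Finset.induction_on generalizing A with
  | empty => exact ⟨[], by simp, by simp, by simp [Circuit.act_nil]⟩
  | insert a J ha ih =>
    rw [Finset.disjoint_insert_right] at hA hI
    obtain ⟨c, hc1, hc2, hc3⟩ := ih (insert a A)
      (Finset.disjoint_insert_left.2 ⟨ha, hA.2⟩) hI.2
    refine ⟨.dft a :: c, by simp [hc1, ha], ?_, ?_⟩
    · intro g hg
      rcases List.mem_cons.1 hg with rfl | hg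
      · trivial
      · exact hc2 g hg
    · have hu : A ∪ insert a J = insert a A ∪ J := by
        rw [Finset.union_insert, Finset.insert_union]
      have hact : Circuit.act (.dft a :: c) =
          Circuit.act c ∘ₗ (Gate.dft a : Gate F n).matrix.vecMulLinear :=
        LinearMap.ext fun v => Circuit.act_cons_apply _ _ _
      rw [hu, ← hc3, hact, Submodule.map_comp]
      congr 1
      -- The transform maps `(X, Z)` at qudit `a` to `(Z, -X)`. The `X`-entry is zero beforehand, so
      -- the `Z`-entry is zero afterwards.
      have haJ : a ∉ I ∪ J := by simp [hI.1, ha]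
      refine le_antisymm ?_ ?_
      · rintro _ ⟨v, ⟨hx, hz⟩, rfl⟩
        refine ⟨fun j hj => ?_, fun j hj => ?_⟩
        · have hja : j ≠ a := by rintro rfl; simp at hj
          have := hx j (by simp_all)
          simpa [LinearMap.funLeft, Gate.matrix, vecMul_singleQudit_inl, hja] using this
        · by_cases hja : j = a
          · subst hja
            have := hx j hA.1
            simpa [LinearMap.funLeft, Gate.matrix, vecMul_singleQudit_inr] using this
          · have := hz j (by simp_all)
            simpa [LinearMap.funLeft, Gate.matrix, vecMul_singleQudit_inr, hja] using this
      · rintro w ⟨hx, hz⟩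
        have hwa : w (Sum.inr a) = 0 := hz a haJ
        refine ⟨Sum.elim (Function.update (w ∘ Sum.inl) a 0)
          (Function.update (w ∘ Sum.inr) a (w (Sum.inl a))), ⟨fun j hj => ?_, fun j hj => ?_⟩, ?_⟩
        · by_cases hja : j = a
          · subst hja; simp [LinearMap.funLeft]
          · have := hx j (by simp_all)
            simpa [LinearMap.funLeft, hja] using this
        · have hja : j ≠ a := by rintro rfl; simp at hj
          have := hz j (by simp_all)
          simpa [LinearMap.funLeft, hja] using this
        · funext i
          rcases i with j | j <;> by_cases hja : j = a
          · subst hja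
            simp [Gate.matrix, vecMul_singleQudit_inl]
          · simp [Gate.matrix, vecMul_singleQudit_inl, hja]
          · subst hja
            simp [Gate.matrix, vecMul_singleQudit_inr, hwa]
          · simp [Gate.matrix, vecMul_singleQudit_inr, hja]

/-! ### Growth of degrees under column operations -/

/-- All exponents that occur in `f` lie between `-B` and `B`. -/
def ExponentsWithin (B : ℕ) (f : F[T;T⁻¹]) : Prop :=
  ∃ p : F[X], p.natDegree ≤ 2 * B ∧ toLaurent p = T B * f

theorem ExponentsWithin.add {B : ℕ} {f g : F[T;T⁻¹]} (hf : ExponentsWithin B f)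
    (hg : ExponentsWithin B g) : ExponentsWithin B (f + g) := by
  obtain ⟨p, hp, hpf⟩ := hf
  obtain ⟨q, hq, hqg⟩ := hg
  exact ⟨p + q, Polynomial.natDegree_add_le_of_degree_le hp hq, by rw [map_add, hpf, hqg, mul_add]⟩

theorem ExponentsWithin.C_mul_T_mul {B K : ℕ} {f : F[T;T⁻¹]} (hf : ExponentsWithin B f) (c : F)
    {ℓ : ℤ} (hℓ : |ℓ| ≤ K) : ExponentsWithin (B + K) (LaurentPolynomial.C c * T ℓ * f) := by
  obtain ⟨p, hp, hpf⟩ := hf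
  rw [abs_le] at hℓ
  obtain ⟨m, hm⟩ := Int.eq_ofNat_of_zero_le (show 0 ≤ ℓ + K by omega)
  refine ⟨Polynomial.C c * X ^ m * p, ?_, ?_⟩
  · have h1 := Polynomial.natDegree_mul_le (p := Polynomial.C c * X ^ m) (q := p)
    have h2 := Polynomial.natDegree_C_mul_X_pow_le c m
    omega
  · replace hm : ℓ + (K : ℤ) = (m : ℤ) := hm
    rw [map_mul, map_mul, Polynomial.toLaurent_C, Polynomial.toLaurent_X_pow, hpf, ← hm, T_add, Nat.cast_add, T_add]
    ring

theorem ExponentsWithin.mono {B B' : ℕ} {f : F[T;T⁻¹]} (hf : ExponentsWithin B f) (h : B ≤ B') :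
    ExponentsWithin B' f := by
  obtain ⟨K, rfl⟩ := Nat.exists_eq_add_of_le h
  simpa using hf.C_mul_T_mul (K := K) 1 (ℓ := 0) (by simp)

theorem exponentsWithin_toLaurent {B : ℕ} {p : F[X]} (hp : p.natDegree ≤ B) :
    ExponentsWithin B (toLaurent p) := by
  refine ⟨X ^ B * p, ?_, by rw [map_mul, Polynomial.toLaurent_X_pow]⟩
  have h := Polynomial.natDegree_mul_le (p := (X : F[X]) ^ B) (q := p)
  rw [Polynomial.natDegree_X_pow] at h
  omega

/-- Each operation adds one entry, times a monomial with shift at most `K`, to another, so it widens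
the exponent window by at most `K`. -/
theorem exponentsWithin_actList {K : ℕ} (l : List (ColumnOp F n)) (hl : ∀ o ∈ l, |o.shift| ≤ K)
    {B : ℕ} {v : Fin n → F[T;T⁻¹]} (hv : ∀ j, ExponentsWithin B (v j)) (j : Fin n) :
    ExponentsWithin (B + l.length * K) (ColumnOp.actList l v j) := by
  induction l generalizing B v with
  | nil => simpa using hv j
  | cons o l ih =>
    have h := ih (fun o' ho' => hl o' (by simp [ho'])) (B := B + K) (v := o.act v) (fun j => by
      rw [ColumnOp.act_apply]
      refine ((hv j).mono (Nat.le_add_right B K)).add ?_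
      split_ifs
      · exact (hv _).C_mul_T_mul _ (hl o (by simp))
      · exact ⟨0, by simp, by simp⟩)
    have hB : B + (o :: l).length * K = B + K + l.length * K := by
      rw [List.length_cons]
      ring
    rw [hB]
    exact h

/-! ### Ranks and orthogonality of row modules -/

theorem rowModule_eq_span {r : ℕ} (H : Matrix (Fin r) (Fin n) F[X]) :
    rowModule H = Submodule.span F[T;T⁻¹] (Set.range fun k j => toLaurent (H k j)) := rfl

/-- A Laurent relation becomes a polynomial one after multiplication by a power of the variable,
which is a unit. -/
theorem FullRank.linearIndependent {r : ℕ} {H : Matrix (Fin r) (Fin n) F[X]} (hH : FullRank H) :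
    LinearIndependent F[T;T⁻¹] fun (k : Fin r) (j : Fin n) => toLaurent (H k j) := by
  rw [Fintype.linearIndependent_iff]
  intro u hu k
  obtain ⟨N, p, hp⟩ := exists_toLaurent_eq_T_mul u
  have hsum : ∑ k, p k • H k = 0 := by
    funext j
    apply Polynomial.toLaurent_injective
    have h := congrFun hu j
    simp only [Finset.sum_apply, Pi.smul_apply, smul_eq_mul, Pi.zero_apply] at h ⊢
    simp only [map_sum, map_mul, hp, mul_assoc, ← Finset.mul_sum, h, mul_zero, map_zero]
  have h0 := hp k
  rw [Fintype.linearIndependent_iff.1 hH p hsum k, map_zero] at h0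
  exact ((LaurentPolynomial.isUnit_T (R := F) (N : ℤ)).mul_right_eq_zero).1 h0.symm

/-- Column operations are invertible and preserve rank. This matches the number of coordinates to
the number of ancillae. -/
theorem FullRank.card_eq {r : ℕ} {H : Matrix (Fin r) (Fin n) F[X]} (hH : FullRank H)
    (l : List (ColumnOp F n)) (I : Finset (Fin n))
    (h : (rowModule H).map (ColumnOp.actList l) = coord F I) : I.card = r := by
  rw [← finrank_coord (F := F) I, ← h, ← LinearEquiv.finrank_eq
    (Submodule.equivMapOfInjective _ (ColumnOp.actList_bijective l).1 (rowModule H)), rowModule_eq_span,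
    finrank_span_eq_card hH.linearIndependent, Fintype.card_fin]

theorem FullRank.le {r : ℕ} {H : Matrix (Fin r) (Fin n) F[X]} (hH : FullRank H) : r ≤ n := by
  simpa using hH.linearIndependent.fintype_card_le_finrank

theorem invert_seqInner (v w : Fin n → F[T;T⁻¹]) :
    LaurentPolynomial.invert (seqInner v w) = seqInner w v := by
  simp only [seqInner, map_sum, map_mul]
  exact Finset.sum_congr rfl fun j _ => by
    rw [LaurentPolynomial.involutive_invert (w j), mul_comm]

/-- The rows of `H₂` lie in the dual of the code they check, hence by hypothesis in the code checked
by `H₁`. -/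
theorem seqInner_eq_zero_of_dualCode_le {r₁ k₂ : ℕ} {H₁ : Matrix (Fin r₁) (Fin n) F[X]}
    {H₂ : Matrix (Fin k₂) (Fin n) F[X]} (h : dualCode (parityCode H₂) ≤ parityCode H₁)
    (i : Fin r₁) {v : Fin n → F[T;T⁻¹]} (hv : v ∈ rowModule H₂) :
    seqInner v (fun j => toLaurent (H₁ i j)) = 0 := by
  have hle : rowModule H₂ ≤ dualCode (parityCode H₂) := by
    rw [rowModule_eq_span, Submodule.span_le]
    rintro _ ⟨k, rfl⟩ c hc
    rw [← invert_seqInner, hc k, map_zero]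
  rw [← invert_seqInner, h (hle hv) i, map_zero]

theorem sum_sup_natDegree_le_constraintLength {r₁ k₂ : ℕ} (H₁ : Matrix (Fin r₁) (Fin n) F[X])
    (H₂ : Matrix (Fin k₂) (Fin n) F[X]) :
    (∑ k, Finset.univ.sup fun j => (H₂ k j).natDegree) +
      (∑ k, Finset.univ.sup fun j => (H₁ k j).natDegree) ≤
        constraintLength (cssStabilizer H₁ H₂) := by
  rw [constraintLength, Fintype.sum_sum_type]
  refine add_le_add (Finset.sum_le_sum fun k _ => ?_) (Finset.sum_le_sum fun k _ => ?_)
  · exact Finset.sup_le fun j _ =>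
      Finset.le_sup (f := fun j => (cssStabilizer H₁ H₂ (Sum.inl k) j).natDegree)
        (Finset.mem_univ (Sum.inl j))
  · exact Finset.sup_le fun j _ =>
      Finset.le_sup (f := fun j => (cssStabilizer H₁ H₂ (Sum.inr k) j).natDegree)
        (Finset.mem_univ (Sum.inr j))

theorem actList_eq_self_of_src_eq_zero (l : List (ColumnOp F n)) (v : Fin n → F[T;T⁻¹])
    (h : ∀ o ∈ l, v o.src = 0) : ColumnOp.actList l v = v := by
  induction l with
  | nil => rfl
  | cons o l ih =>
    have ho : o.act v = v := by
      funext j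
      simp [ColumnOp.act_apply, h o (by simp)]
    rw [ColumnOp.actList_cons, LinearMap.comp_apply, ho]
    exact ih fun o' ho' => h o' (by simp [ho'])

/-! ### Simultaneous reduction and the encoding circuit -/

/-- A bound for the number of column operations that reduce a row module with `n` columns and
sum of row degrees at most `ν`. -/
def opBound (n ν : ℕ) : ℕ := n * n + 2 * n * ν

/-- A bound for the exponents of the second parity check matrix after the reduction of the
first one. -/
def exponentBound (n ν : ℕ) : ℕ := ν + opBound n ν * (ν + 1) ^ 2

/-- Column operations that reduce both parity check matrices simultaneously. -/
theorem exists_ops_reduce_both {r₁ k₂ : ℕ} (H₁ : Matrix (Fin r₁) (Fin n) F[X])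
    (H₂ : Matrix (Fin k₂) (Fin n) F[X]) (hr₁ : FullRank H₁) (hc₁ : NonCatastrophic H₁)
    (hc₂ : NonCatastrophic H₂) (hdual : dualCode (parityCode H₂) ≤ parityCode H₁) :
    ∃ (l : List (ColumnOp F n)) (J₁ J₂ : Finset (Fin n)), Disjoint J₁ J₂ ∧
      (rowModule H₂).map (ColumnOp.actList l) = coord F J₂ ∧
      (rowModule H₁).map (ColumnOp.actList (l.map ColumnOp.dual)) = coord F J₁ ∧
      l.length ≤ opBound n (constraintLength (cssStabilizer H₁ H₂)) +
        opBound n (n * (2 * exponentBound n (constraintLength (cssStabilizer H₁ H₂)))) := by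
  classical
  set ν := constraintLength (cssStabilizer H₁ H₂) with hν
  have hsum := sum_sup_natDegree_le_constraintLength H₁ H₂
  rw [← hν] at hsum
  set d₂ : Fin k₂ → ℕ := fun k => Finset.univ.sup fun j => (H₂ k j).natDegree with hd₂
  have hcard : ∀ J : Finset (Fin n), J.card ≤ n := fun J => by simpa using Finset.card_le_univ J
  have hd₂ν : ∑ k, d₂ k ≤ ν := le_trans (Nat.le_add_right _ _) hsum
  obtain ⟨l₂, J₂, -, hmap₂, hlen₂, hops₂⟩ := reducible_rowModule Finset.univ H₂ d₂
    (fun k j => Finset.le_sup (f := fun j => (H₂ k j).natDegree) (Finset.mem_univ j))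
    (fun k j hj => absurd (Finset.mem_univ j) hj) hc₂.saturated
  have hlen₂' : l₂.length ≤ opBound n ν := by
    refine hlen₂.trans ?_
    unfold opBound
    have := hcard Finset.univ
    gcongr
  set B := exponentBound n ν with hB
  set w : Fin r₁ → Fin n → F[T;T⁻¹] := fun k =>
    ColumnOp.actList (l₂.map ColumnOp.dual) fun j => toLaurent (H₁ k j) with hw
  have hwB : ∀ k j, ExponentsWithin B (w k j) := by
    intro k j
    have h1 : ∀ j, ExponentsWithin ν (toLaurent (H₁ k j)) := by
      intro j
      refine exponentsWithin_toLaurent (le_trans ?_ (le_trans (Nat.le_add_left _ _) hsum))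
      exact (Finset.le_sup (f := fun j => (H₁ k j).natDegree) (Finset.mem_univ j)).trans
        (Finset.single_le_sum (f := fun k => Finset.univ.sup fun j => (H₁ k j).natDegree)
          (by simp) (Finset.mem_univ k))
    -- The shift bound of the first reduction is needed here: it limits the degrees with which the
    -- second one starts.
    refine (exponentsWithin_actList (l₂.map ColumnOp.dual) (K := (ν + 1) ^ 2) ?_ h1 j).mono ?_
    · intro o ho
      obtain ⟨o', ho', rfl⟩ := List.mem_map.1 ho
      refine le_trans (by simpa [ColumnOp.dual] using (hops₂ o' ho').2.2) ?_
      have : (∑ k, d₂ k + 1) ^ 2 ≤ (ν + 1) ^ 2 := by gcongr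
      exact_mod_cast this
    · rw [List.length_map, hB, exponentBound]
      gcongr
  -- Multiplying the rows by the unit `T B` gives polynomials of degree at most `2 * B` without
  -- changing the row module.
  choose H hHdeg hHw using hwB
  have hmap₁ : (rowModule H₁).map (ColumnOp.actList (l₂.map ColumnOp.dual)) = rowModule H := by
    have hrow : ∀ k, (fun j => toLaurent (H k j)) = (T B : F[T;T⁻¹]) • w k := fun k =>
      funext fun j => hHw k j
    have hrow' : ∀ k, w k = (T (-(B : ℤ)) : F[T;T⁻¹]) • fun j => toLaurent (H k j) := by
      intro k
      rw [hrow, smul_smul, ← T_add]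
      simp
    rw [rowModule_eq_span, Submodule.map_span, ← Set.range_comp]
    refine le_antisymm (Submodule.span_le.2 ?_) (Submodule.span_le.2 ?_)
    · rintro _ ⟨k, rfl⟩
      change w k ∈ _
      rw [hrow' k]
      exact Submodule.smul_mem _ _ (row_mem_rowModule H k)
    · rintro _ ⟨k, rfl⟩
      simp only [hrow k]
      exact Submodule.smul_mem _ _ (Submodule.subset_span ⟨k, rfl⟩)
  have hzero : ∀ k j, j ∉ J₂ᶜ → H k j = 0 := by
    intro k j hj
    rw [Finset.notMem_compl] at hj
    -- The unit vector at `j ∈ J₂` comes from the row module of `H₂`, and its inner product with a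
    -- transformed row of `H₁` is the inverted entry at `j`. Orthogonality makes this entry zero.
    have hmem := single_mem_coord (F := F) hj 1
    rw [← hmap₂] at hmem
    obtain ⟨v, hv, hve⟩ := hmem
    have h0 := seqInner_eq_zero_of_dualCode_le hdual k hv
    rw [← ColumnOp.seqInner_actList l₂, hve] at h0
    have h1 : LaurentPolynomial.invert (w k j) = 0 := by
      rw [← h0, seqInner, Finset.sum_eq_single j]
      · simp [hw]
      · intro i _ hij
        simp [hij]
      · simp
    have h2 : w k j = 0 := by simpa using h1
    have h3 := hHw k j
    rw [h2, mul_zero] at h3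
    exact (Polynomial.toLaurent_eq_zero).1 h3
  have hsat : Saturated (rowModule H) := hmap₁ ▸ hc₁.saturated.map (ColumnOp.actList_bijective _)
  obtain ⟨l₁, J₁, hJ₁, hmap, hlen₁, hops₁⟩ :=
    reducible_rowModule J₂ᶜ H (fun _ => 2 * B) hHdeg hzero hsat
  -- The second reduction is meant for the `Z`-part, so its dual is performed on the `X`-part. The
  -- sources of these dual operations lie outside `J₂`, so they fix the already reduced module
  -- pointwise.
  refine ⟨l₂ ++ l₁.map ColumnOp.dual, J₁, J₂, ?_, ?_, ?_, ?_⟩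
  · exact Finset.disjoint_of_subset_left hJ₁ (disjoint_compl_left)
  · rw [ColumnOp.actList_append, Submodule.map_comp, hmap₂]
    have hid : ∀ v ∈ coord F J₂, ColumnOp.actList (l₁.map ColumnOp.dual) v = v := by
      intro v hv
      refine actList_eq_self_of_src_eq_zero _ v fun o ho => ?_
      obtain ⟨o', ho', rfl⟩ := List.mem_map.1 ho
      exact hv _ (Finset.mem_compl.1 (hops₁ o' ho').2.1)
    ext v
    constructor
    · rintro ⟨u, hu, rfl⟩
      rwa [hid u hu]
    · exact fun hv => ⟨v, hv, hid v hv⟩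
  · have : (l₂ ++ l₁.map ColumnOp.dual).map ColumnOp.dual = l₂.map ColumnOp.dual ++ l₁ := by
      simp [Function.comp_def]
    rw [this, ColumnOp.actList_append, Submodule.map_comp, hmap₁, hmap]
  · rw [List.length_append, List.length_map]
    refine add_le_add hlen₂' (hlen₁.trans ?_)
    rw [Finset.sum_const, Finset.card_univ, Fintype.card_fin, smul_eq_mul]
    unfold opBound
    have h1 := hcard J₂ᶜ
    have h2 := hr₁.le
    gcongr

/-- The bound for the depth of the encoding circuit. -/
def depthBound (n ν : ℕ) : ℕ :=
  7 * n + 3 * (opBound n ν + opBound n (n * (2 * exponentBound n ν)))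

theorem exists_encoder {r₁ k₂ : ℕ} (H₁ : Matrix (Fin r₁) (Fin n) F[X])
    (H₂ : Matrix (Fin k₂) (Fin n) F[X]) (hr₁ : FullRank H₁) (hc₁ : NonCatastrophic H₁)
    (hr₂ : FullRank H₂) (hc₂ : NonCatastrophic H₂)
    (hdual : dualCode (parityCode H₂) ≤ parityCode H₁) :
    ∃ c : Circuit F n, Circuit.IsEncoder c (cssStabilizer H₁ H₂) ∧ (∀ g ∈ c, g.IsParallel) ∧
      c.length ≤ depthBound n (constraintLength (cssStabilizer H₁ H₂)) := by
  classical
  obtain ⟨l, J₁, J₂, hdisj, hmap₂, hmap₁, hlen⟩ :=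
    exists_ops_reduce_both H₁ H₂ hr₁ hc₁ hc₂ hdual
  have hcard₁ := hr₁.card_eq _ _ hmap₁
  have hcard₂ := hr₂.card_eq _ _ hmap₂
  have hunion : (J₁ ∪ J₂).card = k₂ + r₁ := by
    rw [Finset.card_union_of_disjoint hdisj, hcard₁, hcard₂, add_comm]
  have hle : k₂ + r₁ ≤ n := by
    rw [← hunion]
    simpa using Finset.card_le_univ (J₁ ∪ J₂)
  have hcard : ∀ J : Finset (Fin n), J.card ≤ n := fun J => by simpa using Finset.card_le_univ J
  obtain ⟨m, hm1, hm2⟩ := exists_ops_map_coord (F := F)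
    (Finset.univ.filter fun j : Fin n => (j : ℕ) < k₂ + r₁) (J₁ ∪ J₂) (by
      rw [hunion, Fin.card_filter_val_lt, min_eq_right hle])
  obtain ⟨c, hc1, hc2, hc3⟩ := exists_circuit_dft (F := F) ∅ J₁ J₂ (by simp) hdisj
  -- The ancillae are moved to `J₁ ∪ J₂`, those in `J₂` become `X`-coordinates, and the reduction is
  -- undone. `m` is dualized because it must act on the `Z`-part; the `X`-part is still zero.
  refine ⟨ColumnOp.circuitList (m.map ColumnOp.dual) ++ c ++
    ColumnOp.circuitList (ColumnOp.invList l), ?_, ?_, ?_⟩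
  · have hbot : (⊥ : Submodule F[T;T⁻¹] (Fin n → F[T;T⁻¹])) = coord F ∅ := by
      refine le_antisymm bot_le fun v hv => ?_
      rw [Submodule.mem_bot]
      exact funext fun j => hv j (by simp)
    have hdd : (m.map ColumnOp.dual).map ColumnOp.dual = m := by simp [Function.comp_def]
    have hinv : (ColumnOp.invList l).map ColumnOp.dual =
        ColumnOp.invList (l.map ColumnOp.dual) := by
      simp [ColumnOp.invList, Function.comp_def, ColumnOp.dual_inv]
    rw [Circuit.IsEncoder, stabilizerSpan_mul_matrix, stabilizerSpan_trivialStabilizer,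
      stabilizerSpan_cssStabilizer, Circuit.act_append, Circuit.act_append, Submodule.map_comp,
      Submodule.map_comp, map_circuitList_cssModule, hdd, Fintype.card_sum, Fintype.card_fin,
      Fintype.card_fin, hm2, Submodule.map_bot, hbot, hc3, Finset.empty_union,
      map_circuitList_cssModule, hinv, ColumnOp.map_actList_invList _ hmap₂,
      ColumnOp.map_actList_invList _ hmap₁]
  · intro g hg
    rw [List.mem_append, List.mem_append] at hg
    rcases hg with (hg | hg) | hg
    · exact ColumnOp.isParallel_circuitList _ g hg
    · exact hc2 g hg
    · exact ColumnOp.isParallel_circuitList _ g hg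
  · have h1 := ColumnOp.length_circuitList_le (m.map ColumnOp.dual)
    have h2 := ColumnOp.length_circuitList_le (ColumnOp.invList l)
    have h3 : (ColumnOp.invList l).length = l.length := by simp [ColumnOp.invList]
    rw [List.length_map] at h1
    rw [List.length_append, List.length_append, depthBound]
    have h4 := hcard J₂
    -- The moves need at most `2 * n` operations of three gates each; with at most `n` Fourier
    -- transforms this gives the term `7 * n`.
    have h5 := hcard ((Finset.univ.filter fun j : Fin n => (j : ℕ) < k₂ + r₁) \ (J₁ ∪ J₂))
    omega

/-- The bound for the depth is a polynomial. -/
theorem exists_mvPolynomial_depthBound :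
    ∃ p : MvPolynomial (Fin 2) ℕ, ∀ n ν : ℕ, MvPolynomial.eval ![n, ν] p = depthBound n ν := by
  let N : MvPolynomial (Fin 2) ℕ := MvPolynomial.X 0
  let V : MvPolynomial (Fin 2) ℕ := MvPolynomial.X 1
  let L : MvPolynomial (Fin 2) ℕ := N * N + 2 * N * V
  let B : MvPolynomial (Fin 2) ℕ := V + L * (V + 1) ^ 2
  refine ⟨7 * N + 3 * (L + (N * N + 2 * N * (N * (2 * B)))), fun n ν => ?_⟩
  simp [N, V, L, B, depthBound, opBound, exponentBound]

end

end QCC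

theorem mainTheorem1 :
    ∃ p : MvPolynomial (Fin 2) ℕ,
      ∀ (F : Type*) [Field F] [Finite F] (n r₁ k₂ : ℕ)
        (H₁ : Matrix (Fin r₁) (Fin n) (Polynomial F)) (H₂ : Matrix (Fin k₂) (Fin n) (Polynomial F)),
        QCC.FullRank H₁ → QCC.NonCatastrophic H₁ → QCC.DelayFree H₁ →
        QCC.FullRank H₂ → QCC.NonCatastrophic H₂ → QCC.DelayFree H₂ →
        QCC.dualCode (QCC.parityCode H₂) ≤ QCC.parityCode H₁ →
        ∃ c : QCC.Circuit F n,
          QCC.Circuit.IsEncoder c (QCC.cssStabilizer H₁ H₂) ∧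
          ∀ N : ℕ, QCC.Circuit.depth c N ≤
            MvPolynomial.eval ![n, QCC.constraintLength (QCC.cssStabilizer H₁ H₂)] p := by
  obtain ⟨p, hp⟩ := QCC.exists_mvPolynomial_depthBound
  refine ⟨p, ?_⟩
  intro F _ _ n r₁ k₂ H₁ H₂ hr₁ hc₁ _ hr₂ hc₂ _ hdual
  obtain ⟨c, henc, hpar, hlen⟩ := QCC.exists_encoder H₁ H₂ hr₁ hc₁ hr₂ hc₂ hdual
  refine ⟨c, henc, fun N => ?_⟩
  rw [hp]
  exact (QCC.Circuit.depth_le_length hpar N).trans hlen
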